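/- **Theorem (Elimination of Exotic Spirals).** Let $\theta_0<0$ and $r_1,r_2\ge 0$, and put $$\theta=(\theta_0,\theta_0,\theta_0)',\qquad \Gamma=I,\qquad R=\begin{pmatrix}1&r_2&r_1\\ r_1&1&r_2\\ r_2&r_1&1\end{pmatrix}.$$ Assume Condition 1: $r_1>r_2$, $-1<r_1+r_2<2$, and $$(1+r_2^2)(1+r_1^2-r_2-r_1r_2)^2\ \ge\ 2(r_1r_2)^2(1+r_1^2+r_2^2-r_1-r_2-r_1r_2).$$ *Variational problem.* A triple $(x,y,z)$ of continuous functions $[0,\infty)\to\mathbb R^3$ is a Skorohod triple if $z(t)=x(t)+Ry(t)\ge 0$ for all $t\ge0$, each $y_i$ is non-decreasing, $y(0)=0$, and $\int_0^\infty z_i\,dy_i=0$ for $i=1,2,3$. For $v\in\mathbb R^3_+$ and $T\ge 0$, a feasible triple to $v$ with time $T$ is a Skorohod triple such that $x$ is absolutely continuous with square integrable derivative on bounded intervals, $x(0)=0$, and $z(T)=v$; its cost is $\frac12\int_0^T|\dot x(t)-\theta|^2\,dt$, with $|\cdot|$ the Euclidean norm. The triple is optimal if its cost equals $I(v)$, the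 infimum of the costs of all feasible triples to $v$ over all times $T\ge0$; then $z$ (on $[0,T]$) is called an optimal path to $v$. *Segments.* The segments of $z$ on $[0,T]$ are the maximal nondegenerate subintervals of $[0,T]$ on which $z$ is an affine function of time. The path consists of countably infinitely many segments if there are infinitely (necessarily countably) many of them and they cover almost all of $[0,T]$. It is a classic spiral, i.e. of the form $(A,A,A,\dots,O)$, if $z(0)=0$ and there are times $T=t_0>t_1>t_2>\cdots$ with $t_n\to0$ such that $z$ is affine on each $[t_{n+1},t_n]$ and each $z(t_n)$ is a point, other than the origin, of one of the three coordinate half-axes, these half-axes being visited in a fixed cyclic order as $n$ increases. *Claim.* Let $v\neq0$ be a point on one of the three coordinate half-axes of $\mathbb R^3_+$, and let $(x,y,z)$ be an optimal triple to $v$ with time $T$ such that $z$ consists on $[0,T]$ of countably infinitely many segments. Then there is a feasible triple $(x',y',z')$ to $v$ with some time $T'$ such that $z'$ is a classic spiral on $[0,T']$ and $$\frac12\int_0^{T'}|\dot x'(t)-\theta|^2\,dt\ \le\ \frac12\int_0^{T}|\dot x(t)-\theta|^2\,dt .$$ -/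

import Mathlib

open MeasureTheory Set Filter Topology

namespace RSVP

/-- `(z, y)` is an `R`-regulation of the path `x` (a solution of the Skorohod problem).
Paths are functions of time whose values on `[0, ∞)` are the only ones that matter.
The last field says `∫₀^∞ z_i dy_i = 0`, where `dy_i` is the Lebesgue–Stieltjes measure of
`y_i`, extended to negative times by the constant `y_i(0)`. -/
structure IsRegulation {d : ℕ} (R : Matrix (Fin d) (Fin d) ℝ) (x y z : ℝ → Fin d → ℝ) :
    Prop where
  cont_x : ContinuousOn x (Ici 0)
  cont_y : ContinuousOn y (Ici 0)
  cont_z : ContinuousOn z (Ici 0)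
  eq : ∀ t, 0 ≤ t → z t = x t + R.mulVec (y t)
  nonneg : ∀ t, 0 ≤ t → 0 ≤ z t
  mono : ∀ i, Monotone fun t : ℝ => y (max t 0) i
  y_zero : y 0 = 0
  compl : ∀ i, ∫⁻ t in Ici (0 : ℝ), ENNReal.ofReal (z t i) ∂(mono i).stieltjesFunction.measure = 0

/-- The space `𝓗^d`: paths starting at the origin that are absolutely continuous, with a square
integrable derivative, on bounded intervals. -/
structure IsFiniteEnergyPath {d : ℕ} (x : ℝ → Fin d → ℝ) : Prop where
  zero : x 0 = 0
  ac : ∀ T, 0 < T → AbsolutelyContinuousOnInterval x 0 T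
  sq : ∀ T, 0 < T → MemLp (deriv x) 2 (volume.restrict (Ioc 0 T))

/-- The squared norm `‖v‖² = v' Γ⁻¹ v`. -/
noncomputable def normSq {d : ℕ} (Γ : Matrix (Fin d) (Fin d) ℝ) (v : Fin d → ℝ) : ℝ :=
  v ⬝ᵥ (Γ⁻¹).mulVec v

/-- The cost `½ ∫₀^T ‖ẋ(t) - θ‖² dt`. -/
noncomputable def cost {d : ℕ} (θ : Fin d → ℝ) (Γ : Matrix (Fin d) (Fin d) ℝ)
    (x : ℝ → Fin d → ℝ) (T : ℝ) : ℝ :=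
  (1 / 2) * ∫ t in (0 : ℝ)..T, normSq Γ (deriv x t - θ)

/-- `(x, y, z)` is feasible for the variational problem with terminal point `v`, and `z` reaches
`v` at time `T`. -/
structure IsFeasible {d : ℕ} (R : Matrix (Fin d) (Fin d) ℝ) (v : Fin d → ℝ) (T : ℝ)
    (x y z : ℝ → Fin d → ℝ) : Prop where
  path : IsFiniteEnergyPath x
  regulation : IsRegulation R x y z
  time_nonneg : 0 ≤ T
  terminal : z T = v

/-- The optimal value `I(v)` of the variational problem. -/
noncomputable def value {d : ℕ} (θ : Fin d → ℝ) (Γ R : Matrix (Fin d) (Fin d) ℝ)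
    (v : Fin d → ℝ) : ℝ :=
  sInf {c | ∃ T x y z, IsFeasible R v T x y z ∧ c = cost θ Γ x T}

/-- `(x, y, z)` is an optimal triple for `v`, with optimal time `T`; `z` is then an optimal
path. -/
def IsOptimalTriple {d : ℕ} (θ : Fin d → ℝ) (Γ R : Matrix (Fin d) (Fin d) ℝ)
    (v : Fin d → ℝ) (T : ℝ) (x y z : ℝ → Fin d → ℝ) : Prop :=
  IsFeasible R v T x y z ∧ cost θ Γ x T = value θ Γ R v

/-- Rotationally symmetric data `(θ, Γ, R)` with parameters `θ₀`, `r₁`, `r₂`. -/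
structure IsRotationallySymmetric (θ : Fin 3 → ℝ) (Γ R : Matrix (Fin 3) (Fin 3) ℝ)
    (θ₀ r₁ r₂ : ℝ) : Prop where
  reflection : R = !![1, r₂, r₁; r₁, 1, r₂; r₂, r₁, 1]
  drift : θ = ![θ₀, θ₀, θ₀]
  posDef : Γ.PosDef
  covariance : ∃ σ ρ : ℝ, -1 < ρ ∧ ρ < 1 ∧
    Γ = !![σ ^ 2, ρ * σ ^ 2, ρ * σ ^ 2; ρ * σ ^ 2, σ ^ 2, ρ * σ ^ 2; ρ * σ ^ 2, ρ * σ ^ 2, σ ^ 2]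

/-- The parameter region `R_f`. -/
def paramRegion : Set (ℝ × ℝ) :=
  {r | 0 ≤ r.1 ∧ 0 ≤ r.2 ∧ r.2 < r.1 ∧ -1 < r.1 + r.2 ∧ r.1 + r.2 < 2}

/-- Condition 1. -/
def Condition1 (r₁ r₂ : ℝ) : Prop :=
  (r₁, r₂) ∈ paramRegion ∧
    2 * (r₁ * r₂) ^ 2 * (1 + r₁ ^ 2 + r₂ ^ 2 - r₁ - r₂ - r₁ * r₂) ≤
      (1 + r₂ ^ 2) * (1 + r₁ ^ 2 - r₂ - r₁ * r₂) ^ 2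

/-- The interior of the `i`-th axis of the octant. -/
def axisInterior (i : Fin 3) : Set (Fin 3 → ℝ) :=
  {v | 0 < v i ∧ ∀ j, j ≠ i → v j = 0}

/-- `z` is linear (constant velocity) on the time interval `[a, b]`. -/
def IsLinearOn {d : ℕ} (z : ℝ → Fin d → ℝ) (a b : ℝ) : Prop :=
  ∃ p q : Fin d → ℝ, ∀ t ∈ Icc a b, z t = p + t • q

/-- The linear segments of `z` on `[0, T]`, given by their time intervals: the maximal
nondegenerate intervals on which `z` is linear. -/
def segments {d : ℕ} (z : ℝ → Fin d → ℝ) (T : ℝ) : Set (ℝ × ℝ) :=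
  {s | s.1 < s.2 ∧ 0 ≤ s.1 ∧ s.2 ≤ T ∧ IsLinearOn z s.1 s.2 ∧
    ∀ a b, 0 ≤ a → a ≤ s.1 → s.2 ≤ b → b ≤ T → IsLinearOn z a b → a = s.1 ∧ b = s.2}

/-- `z` consists on `[0, T]` of a countably infinite number of linear segments. The segments may
be ordered and may accumulate in any way, as long as almost every time belongs to one. -/
def HasCountablyInfinitelyManySegments {d : ℕ} (z : ℝ → Fin d → ℝ) (T : ℝ) : Prop :=
  (segments z T).Infinite ∧ (segments z T).Countable ∧
    volume (Icc 0 T \ ⋃ s ∈ segments z T, Icc s.1 s.2) = 0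

/-- `z` is on `[0, T]` a classic spiral `(A, A, A, …, O)`: traversed backwards in time from its
terminal point, it is a sequence of linear segments that all end in the interior of an axis,
which winds around the three axes in a fixed cyclic order and reaches the origin in the limit,
at time `0`. -/
def IsClassicSpiral (z : ℝ → Fin 3 → ℝ) (T : ℝ) : Prop :=
  z 0 = 0 ∧ ∃ (t : ℕ → ℝ) (i : ℕ → Fin 3) (δ : Fin 3),
    t 0 = T ∧ StrictAnti t ∧ Tendsto t atTop (𝓝 0) ∧
    δ ≠ 0 ∧ (∀ n, i (n + 1) = i n + δ) ∧
    ∀ n, z (t n) ∈ axisInterior (i n) ∧ IsLinearOn z (t (n + 1)) (t n)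

end RSVP

/-! Two symmetries reduce the problem to a single constant. Scaling time and space by the same
factor preserves velocities, and rotating the coordinates preserves the drift and `R`. So the least
cost of reaching a point at distance `x` on any axis is `κ * x`, with one `κ` for all axes, and an
optimal path that visits such a point has spent exactly `κ * x` by then. The proof is a dichotomy on
`HasDirectStep`: a straight motion inside a face, from one axis to a farther point of another,
costing at most `κ` per unit of distance gained.

If a direct step exists, its rescaled and rotated copies fit together into a classic spiral, and a
geometric series bounds its cost by `κ * x₀` (`HasDirectStep.exists_spiral`). This spiral need not
resemble the given path. If none exists, the optimal path has only finitely many segments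
(`IsAxisOpt.finite_segments`), contrary to assumption.

Finiteness comes from first-order conditions. The momentum `g i` is constant on each component of
`{z i > 0}` (`IsOpt.exists_slope`), and equals `κ` if the component contains a visit to the `i`-th
axis (`IsOpt.slope_eq`). Since the entries of `R` are nonnegative, regulation of the other
coordinates only pushes `z i` up. Hence a component that starts while no other coordinate is
regulated has upward drift `θ i + m > 0` and lasts until `T` (`IsOpt.pos_of_start`); as the path
ends on axis `i₀`, only `i = i₀` is possible. If `θ₀ + κ < 0`, a component that starts away from the
origin and reaches its axis must start on another axis, with the third coordinate regulated, and
following it to the first zero of the old coordinate exhibits a direct step. If `θ₀ + κ ≥ 0`, a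
coordinate whose axis has been visited cannot return to zero. Consequently, without a direct step
each coordinate starts at most one excursion strictly after the last time at the origin; until that
time the path rests there, by stability (`IsPiece.eq_zero_of_energy`). So the sign pattern of `z`
changes finitely often, and while it is constant the path is affine, by strict convexity of the cost
and definiteness of `R` (`IsOpt.isLinearOn`). -/

namespace RSVP

/-! ### Elementary regulated pieces: restriction, scaling, concatenation, rotation -/

section

/-- `(g, y, z)` describes a regulated path on `[a, b]` in elementary terms: `g` is the derivative
of the unregulated path minus the drift `θ`, and `y i` is constant wherever `z i` is positive. -/
structure IsPiece {d : ℕ} (θ : Fin d → ℝ) (R : Matrix (Fin d) (Fin d) ℝ) (a b : ℝ)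
    (g y z : ℝ → Fin d → ℝ) : Prop where
  le : a ≤ b
  int : ∀ i, IntervalIntegrable (fun t => g t i) volume a b
  int_sq : ∀ i, IntervalIntegrable (fun t => g t i ^ 2) volume a b
  cont : ∀ i, ContinuousOn (fun t => y t i) (Icc a b)
  mono : ∀ i, MonotoneOn (fun t => y t i) (Icc a b)
  eq : ∀ t ∈ Icc a b, ∀ i, z t i =
    z a i + (t - a) * θ i + (∫ s in a..t, g s i) + ∑ j, R i j * (y t j - y a j)
  nonneg : ∀ t ∈ Icc a b, ∀ i, 0 ≤ z t i
  compl : ∀ i, ∀ s ∈ Icc a b, ∀ t ∈ Icc a b, s ≤ t → (∀ r ∈ Icc s t, 0 < z r i) →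
    y t i = y s i

/-- The cost accumulated on `[a, b]`. -/
noncomputable def energy {d : ℕ} (g : ℝ → Fin d → ℝ) (a b : ℝ) : ℝ :=
  1 / 2 * ∑ i, ∫ t in a..b, g t i ^ 2

/-- The point `q` can be reached from `p` at cost `c`. -/
def Reach {d : ℕ} (θ : Fin d → ℝ) (R : Matrix (Fin d) (Fin d) ℝ) (p q : Fin d → ℝ) (c : ℝ) :
    Prop :=
  ∃ a b g y z, IsPiece θ R a b g y z ∧ z a = p ∧ z b = q ∧ energy g a b = c

variable {d : ℕ} {θ : Fin d → ℝ} {R : Matrix (Fin d) (Fin d) ℝ} {a b s t : ℝ}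
  {g y z : ℝ → Fin d → ℝ}

theorem IsPiece.int_of_mem (h : IsPiece θ R a b g y z) (hs : s ∈ Icc a b) (ht : t ∈ Icc a b)
    (i : Fin d) : IntervalIntegrable (fun r => g r i) volume s t :=
  (h.int i).mono_set (by
    rw [uIcc_of_le h.le]; exact uIcc_subset_Icc hs ht)

theorem IsPiece.int_sq_of_mem (h : IsPiece θ R a b g y z) (hs : s ∈ Icc a b) (ht : t ∈ Icc a b)
    (i : Fin d) : IntervalIntegrable (fun r => g r i ^ 2) volume s t :=
  (h.int_sq i).mono_set (by
    rw [uIcc_of_le h.le]; exact uIcc_subset_Icc hs ht)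

theorem IsPiece.increment (h : IsPiece θ R a b g y z) (hs : s ∈ Icc a b) (ht : t ∈ Icc a b)
    (i : Fin d) : z t i = z s i + (t - s) * θ i + (∫ r in s..t, g r i) +
      ∑ j, R i j * (y t j - y s j) := by
  have ha : a ∈ Icc a b := ⟨le_rfl, h.le⟩
  rw [h.eq t ht i, h.eq s hs i, ← intervalIntegral.integral_add_adjacent_intervals
    (h.int_of_mem ha hs i) (h.int_of_mem hs ht i)]
  have : ∑ j, R i j * (y t j - y a j) =
      ∑ j, R i j * (y s j - y a j) + ∑ j, R i j * (y t j - y s j) := by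
    rw [← Finset.sum_add_distrib]
    exact Finset.sum_congr rfl fun j _ => by ring
  rw [this]; ring

theorem IsPiece.restrict (h : IsPiece θ R a b g y z) (hs : s ∈ Icc a b) (ht : t ∈ Icc a b)
    (hst : s ≤ t) : IsPiece θ R s t g y z where
  le := hst
  int i := h.int_of_mem hs ht i
  int_sq i := h.int_sq_of_mem hs ht i
  cont i := (h.cont i).mono (Icc_subset_Icc hs.1 ht.2)
  mono i := (h.mono i).mono (Icc_subset_Icc hs.1 ht.2)
  eq _ hr i := h.increment hs ⟨hs.1.trans hr.1, hr.2.trans ht.2⟩ i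
  nonneg r hr i := h.nonneg r ⟨hs.1.trans hr.1, hr.2.trans ht.2⟩ i
  compl i r hr r' hr' := h.compl i r ⟨hs.1.trans hr.1, hr.2.trans ht.2⟩ r'
    ⟨hs.1.trans hr'.1, hr'.2.trans ht.2⟩

theorem IsPiece.continuousOn (h : IsPiece θ R a b g y z) (i : Fin d) :
    ContinuousOn (fun t => z t i) (Icc a b) := by
  have h1 : ContinuousOn (fun t => ∫ r in a..t, g r i) (Icc a b) := by
    have := intervalIntegral.continuousOn_primitive_interval (μ := volume) (f := fun r => g r i)
      (a := a) (b := b) (by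
        rw [uIcc_of_le h.le]
        exact (intervalIntegrable_iff_integrableOn_Icc_of_le h.le).1 (h.int i))
    rwa [uIcc_of_le h.le] at this
  have h2 : ContinuousOn (fun t => z a i + (t - a) * θ i + (∫ s in a..t, g s i) +
      ∑ j, R i j * (y t j - y a j)) (Icc a b) := by
    refine ContinuousOn.add (ContinuousOn.add (by fun_prop) h1) ?_
    refine continuousOn_finsetSum _ fun j _ => ?_
    exact continuousOn_const.mul ((h.cont j).sub continuousOn_const)
  exact h2.congr fun t ht => h.eq t ht i

theorem energy_add (h : IsPiece θ R a b g y z) {r : ℝ} (hr : r ∈ Icc a b) :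
    energy g a b = energy g a r + energy g r b := by
  unfold energy
  rw [← mul_add, ← Finset.sum_add_distrib]
  congr 1
  refine Finset.sum_congr rfl fun i _ => ?_
  rw [intervalIntegral.integral_add_adjacent_intervals
    (h.int_sq_of_mem ⟨le_rfl, h.le⟩ hr i) (h.int_sq_of_mem hr ⟨h.le, le_rfl⟩ i)]

theorem energy_nonneg (hab : a ≤ b) : 0 ≤ energy g a b := by
  unfold energy
  refine mul_nonneg (by norm_num) (Finset.sum_nonneg fun i _ => ?_)
  exact intervalIntegral.integral_nonneg hab fun t _ => sq_nonneg _

theorem IsPiece.reach (h : IsPiece θ R a b g y z) : Reach θ R (z a) (z b) (energy g a b) :=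
  ⟨a, b, g, y, z, h, rfl, rfl, rfl⟩

/-- Space and time are scaled by the same `l`, so velocities, and with them `g`, keep their values;
the cost changes only through the duration. -/
theorem IsPiece.affine_time (h : IsPiece θ R a b g y z) {l : ℝ} (hl : 0 < l) (c : ℝ) :
    IsPiece θ R (l * a + c) (l * b + c) (fun t => g ((t - c) / l))
      (fun t => l • y ((t - c) / l)) (fun t => l • z ((t - c) / l)) ∧
    energy (fun t => g ((t - c) / l)) (l * a + c) (l * b + c) = l * energy g a b := by
  have key : ∀ t ∈ Icc (l * a + c) (l * b + c), (t - c) / l ∈ Icc a b := by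
    intro t ht
    constructor
    · rw [le_div_iff₀ hl]; linarith [ht.1]
    · rw [div_le_iff₀ hl]; linarith [ht.2]
  have e1 : ∀ u : ℝ, (l * u + c - c) / l = u := fun u => by field_simp; ring
  have hint : ∀ f : ℝ → ℝ, ∀ u v : ℝ, ∫ t in (l * u + c)..v, f ((t - c) / l) =
      l * ∫ t in u..((v - c) / l), f t := by
    intro f u v
    have e2 : ∀ t : ℝ, (t - c) / l = t / l - c / l := fun t => by rw [sub_div]
    simp_rw [e2]
    rw [intervalIntegral.integral_comp_div_sub (fun t => f t) hl.ne' (c / l), smul_eq_mul]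
    congr 2
    field_simp; ring
  have hii : ∀ f : ℝ → ℝ, IntervalIntegrable f volume a b →
      IntervalIntegrable (fun t => f ((t - c) / l)) volume (l * a + c) (l * b + c) := by
    intro f hf
    have h1 := (hf.comp_mul_left (c := l⁻¹)).comp_sub_right c
    have h2 : ∀ u : ℝ, u / l⁻¹ + c = l * u + c := fun u => by field_simp
    rw [h2, h2] at h1
    refine h1.congr ?_
    intro t _
    simp only [div_eq_inv_mul]
  have hmaps : MapsTo (fun t => (t - c) / l) (Icc (l * a + c) (l * b + c)) (Icc a b) := key
  refine ⟨⟨by nlinarith [h.le], fun i => hii _ (h.int i), fun i => hii _ (h.int_sq i), ?_, ?_,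
    ?_, ?_, ?_⟩, ?_⟩
  · intro i
    simp only [Pi.smul_apply, smul_eq_mul]
    exact continuousOn_const.mul ((h.cont i).comp (by fun_prop) hmaps)
  · intro i u hu v hv huv
    simp only [Pi.smul_apply, smul_eq_mul]
    exact mul_le_mul_of_nonneg_left (h.mono i (key u hu) (key v hv) (by gcongr)) hl.le
  · intro t ht i
    simp only [Pi.smul_apply, smul_eq_mul, e1]
    rw [hint (fun t => g t i) a t, h.eq _ (key t ht) i]
    have : ∑ j, R i j * (l * y ((t - c) / l) j - l * y a j) =
        l * ∑ j, R i j * (y ((t - c) / l) j - y a j) := by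
      rw [Finset.mul_sum]
      exact Finset.sum_congr rfl fun j _ => by ring
    rw [this]
    field_simp
    ring
  · intro t ht i
    exact mul_nonneg hl.le (h.nonneg _ (key t ht) i)
  · intro i u hu v hv huv hpos
    simp only [Pi.smul_apply, smul_eq_mul]
    rw [h.compl i _ (key u hu) _ (key v hv) (by gcongr)]
    intro r hr
    have := hpos (l * r + c) ⟨by
      have := hr.1; rw [div_le_iff₀ hl] at this; linarith, by
      have := hr.2; rw [le_div_iff₀ hl] at this; linarith⟩
    simp only [Pi.smul_apply, smul_eq_mul, e1] at this
    exact pos_of_mul_pos_right this hl.le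
  · unfold energy
    have : ∀ i, ∫ t in (l * a + c)..(l * b + c), g ((t - c) / l) i ^ 2 =
        l * ∫ t in a..b, g t i ^ 2 := by
      intro i
      rw [hint (fun t => g t i ^ 2) a, e1]
    simp_rw [this, ← Finset.mul_sum]
    ring

theorem Reach.smul {p q : Fin d → ℝ} {c l : ℝ} (h : Reach θ R p q c) (hl : 0 < l) :
    Reach θ R (l • p) (l • q) (l * c) := by
  obtain ⟨a, b, g, y, z, h, rfl, rfl, rfl⟩ := h
  obtain ⟨h1, h2⟩ := h.affine_time hl 0
  refine ⟨_, _, _, _, _, h1, ?_, ?_, h2⟩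
  · simp [hl.ne']
  · simp [hl.ne']

theorem IsPiece.glue {c : ℝ} {g' y' z' : ℝ → Fin d → ℝ} (h : IsPiece θ R a b g y z)
    (h' : IsPiece θ R b c g' y' z') (hz : z b = z' b) :
    ∃ G Y Z, IsPiece θ R a c G Y Z ∧ (∀ t ∈ Icc a b, Z t = z t) ∧ (∀ t ∈ Icc b c, Z t = z' t) ∧
      energy G a c = energy g a b + energy g' b c := by
  set G : ℝ → Fin d → ℝ := fun t => if t ≤ b then g t else g' t with hG
  -- Only increments of `y` matter, so the second regulator is shifted to continue the first; no
  -- matching condition on `y` is needed.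
  set Y : ℝ → Fin d → ℝ := fun t => if t ≤ b then y t else y b + (y' t - y' b) with hY
  set Z : ℝ → Fin d → ℝ := fun t => if t ≤ b then z t else z' t with hZ
  have hG1 : ∀ i, ∀ t ∈ Ioc a b, G t i = g t i := fun i t ht => by simp [hG, ht.2]
  have hG2 : ∀ i, ∀ t ∈ Ioc b c, G t i = g' t i := fun i t ht => by simp [hG, ht.1.not_ge]
  have hY1 : ∀ t ∈ Icc a b, Y t = y t := fun t ht => by simp [hY, ht.2]
  have hY2 : ∀ t ∈ Icc b c, Y t = y b + (y' t - y' b) := fun t ht => by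
    rcases ht.1.eq_or_lt with rfl | hlt
    · simp [hY]
    · simp [hY, hlt.not_ge]
  have hZ1 : ∀ t ∈ Icc a b, Z t = z t := fun t ht => by simp [hZ, ht.2]
  have hZ2 : ∀ t ∈ Icc b c, Z t = z' t := fun t ht => by
    rcases ht.1.eq_or_lt with rfl | hlt
    · simp [hZ, hz]
    · simp [hZ, hlt.not_ge]
  have hab := h.le
  have hbc := h'.le
  have hP1 : IsPiece θ R a b G Y Z := by
    refine ⟨hab, fun i => (h.int i).congr ?_, fun i => (h.int_sq i).congr ?_,
      fun i => (h.cont i).congr fun t ht => by rw [hY1 t ht],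
      fun i u hu v hv huv => ?_, fun t ht i => ?_, fun t ht i => ?_,
      fun i u hu v hv huv hpos => ?_⟩
    · rw [uIoc_of_le hab]; intro t ht; exact (hG1 i t ht).symm
    · rw [uIoc_of_le hab]; intro t ht; simp only [hG1 i t ht]
    · simp only [hY1 u hu, hY1 v hv]; exact h.mono i hu hv huv
    · rw [hZ1 t ht, hZ1 a ⟨le_rfl, hab⟩, hY1 t ht, hY1 a ⟨le_rfl, hab⟩, h.eq t ht i]
      congr 2
      refine intervalIntegral.integral_congr_ae (ae_of_all _ fun r hr => ?_)
      rw [uIoc_of_le ht.1] at hr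
      exact (hG1 i r ⟨hr.1, hr.2.trans ht.2⟩).symm
    · rw [hZ1 t ht]; exact h.nonneg t ht i
    · rw [hY1 u hu, hY1 v hv]
      refine h.compl i u hu v hv huv fun r hr => ?_
      rw [← hZ1 r ⟨hu.1.trans hr.1, hr.2.trans hv.2⟩]; exact hpos r hr
  have hP2 : IsPiece θ R b c G Y Z := by
    refine ⟨hbc, fun i => (h'.int i).congr ?_, fun i => (h'.int_sq i).congr ?_,
      fun i => ContinuousOn.congr (f := fun t => y b i + (y' t i - y' b i))
        (continuousOn_const.add ((h'.cont i).sub continuousOn_const))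
        fun t ht => by rw [hY2 t ht]; simp,
      fun i u hu v hv huv => ?_, fun t ht i => ?_, fun t ht i => ?_,
      fun i u hu v hv huv hpos => ?_⟩
    · rw [uIoc_of_le hbc]; intro t ht; exact (hG2 i t ht).symm
    · rw [uIoc_of_le hbc]; intro t ht; simp only [hG2 i t ht]
    · simp only [hY2 u hu, hY2 v hv, Pi.add_apply, Pi.sub_apply]
      have := h'.mono i hu hv huv
      simp only at this
      linarith
    · rw [hZ2 t ht, hZ2 b ⟨le_rfl, hbc⟩, hY2 t ht, hY2 b ⟨le_rfl, hbc⟩, h'.eq t ht i]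
      simp only [Pi.add_apply, Pi.sub_apply, sub_self, Pi.zero_apply, add_zero, add_sub_cancel_left]
      congr 2
      refine intervalIntegral.integral_congr_ae (ae_of_all _ fun r hr => ?_)
      rw [uIoc_of_le ht.1] at hr
      exact (hG2 i r ⟨hr.1, hr.2.trans ht.2⟩).symm
    · rw [hZ2 t ht]; exact h'.nonneg t ht i
    · rw [hY2 u hu, hY2 v hv]
      simp only [Pi.add_apply, Pi.sub_apply]
      rw [h'.compl i u hu v hv huv fun r hr => ?_]
      rw [← hZ2 r ⟨hu.1.trans hr.1, hr.2.trans hv.2⟩]; exact hpos r hr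
  have hb1 : b ∈ Icc a b := ⟨hab, le_rfl⟩
  have hb2 : b ∈ Icc b c := ⟨le_rfl, hbc⟩
  have hP : IsPiece θ R a c G Y Z := by
    refine ⟨hab.trans hbc, fun i => (hP1.int i).trans (hP2.int i),
      fun i => (hP1.int_sq i).trans (hP2.int_sq i), fun i => ?_, fun i => ?_, fun t ht i => ?_,
      fun t ht i => ?_, fun i u hu v hv huv hpos => ?_⟩
    · rw [← Icc_union_Icc_eq_Icc hab hbc]
      exact (hP1.cont i).union_of_isClosed (hP2.cont i) isClosed_Icc isClosed_Icc
    · rw [← Icc_union_Icc_eq_Icc hab hbc]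
      exact (hP1.mono i).union_right (hP2.mono i) ⟨hb1, fun x hx => hx.2⟩
        ⟨hb2, fun x hx => hx.1⟩
    · rcases le_total t b with htb | htb
      · exact hP1.eq t ⟨ht.1, htb⟩ i
      · have e2 := hP2.eq t ⟨htb, ht.2⟩ i
        have e1 := hP1.eq b hb1 i
        rw [e2, e1, ← intervalIntegral.integral_add_adjacent_intervals (hP1.int i)
          (hP2.int_of_mem hb2 ⟨htb, ht.2⟩ i)]
        have : ∑ j, R i j * (Y t j - Y a j) =
            ∑ j, R i j * (Y b j - Y a j) + ∑ j, R i j * (Y t j - Y b j) := by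
          rw [← Finset.sum_add_distrib]
          exact Finset.sum_congr rfl fun j _ => by ring
        rw [this]; ring
    · rcases le_total t b with htb | htb
      · exact hP1.nonneg t ⟨ht.1, htb⟩ i
      · exact hP2.nonneg t ⟨htb, ht.2⟩ i
    · rcases le_total v b with hvb | hvb
      · exact hP1.compl i u ⟨hu.1, huv.trans hvb⟩ v ⟨hv.1, hvb⟩ huv hpos
      · rcases le_total b u with hub | hub
        · exact hP2.compl i u ⟨hub, hu.2⟩ v ⟨hvb, hv.2⟩ huv hpos
        · rw [hP2.compl i b hb2 v ⟨hvb, hv.2⟩ hvb fun r hr => hpos r ⟨hub.trans hr.1, hr.2⟩]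
          exact hP1.compl i u ⟨hu.1, hub⟩ b hb1 hub fun r hr => hpos r ⟨hr.1, hr.2.trans hvb⟩
  refine ⟨G, Y, Z, hP, hZ1, hZ2, ?_⟩
  rw [energy_add hP (r := b) ⟨hab, hbc⟩]
  unfold energy
  congr 2
  · refine Finset.sum_congr rfl fun i _ => ?_
    refine intervalIntegral.integral_congr_ae (ae_of_all _ fun r hr => ?_)
    rw [uIoc_of_le hab] at hr
    simp only [hG1 i r hr]
  · refine Finset.sum_congr rfl fun i _ => ?_
    refine intervalIntegral.integral_congr_ae (ae_of_all _ fun r hr => ?_)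
    rw [uIoc_of_le hbc] at hr
    simp only [hG2 i r hr]

theorem Reach.trans {p q r : Fin d → ℝ} {c c' : ℝ} (h : Reach θ R p q c)
    (h' : Reach θ R q r c') : Reach θ R p r (c + c') := by
  obtain ⟨a, b, g, y, z, h, rfl, rfl, rfl⟩ := h
  obtain ⟨a', b', g', y', z', h', hq, rfl, rfl⟩ := h'
  obtain ⟨h1, h2⟩ := h'.affine_time one_pos (b - a')
  simp only [one_mul, div_one, one_smul, add_sub_cancel] at h1 h2
  obtain ⟨G, Y, Z, hP, hZ1, hZ2, hE⟩ := h.glue h1 (by simp [hq])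
  refine ⟨_, _, G, Y, Z, hP, hZ1 a ⟨le_rfl, h.le⟩, ?_, by rw [hE, h2]⟩
  rw [hZ2 _ ⟨h1.le, le_rfl⟩]
  simp

theorem Reach.refl {p : Fin d → ℝ} (hp : 0 ≤ p) : Reach θ R p p 0 := by
  refine ⟨0, 0, 0, 0, fun _ => p, ⟨le_rfl, by simp, by simp, fun i => continuousOn_const,
    fun i => monotoneOn_const, ?_, fun _ _ i => hp i, by simp⟩, rfl, rfl, by simp [energy]⟩
  intro t ht i
  obtain rfl : t = 0 := le_antisymm ht.2 ht.1
  simp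

/-- All coordinates of the drift agree and `R` is circulant, so a cyclic relabelling is a symmetry
of the problem. -/
theorem Reach.rotate {θ₀ : ℝ} {R : Matrix (Fin 3) (Fin 3) ℝ}
    (hR : ∀ m i j, R (i + m) (j + m) = R i j) {p q : Fin 3 → ℝ} {c : ℝ}
    (h : Reach (fun _ => θ₀) R p q c) (m : Fin 3) :
    Reach (fun _ => θ₀) R (fun i => p (i + m)) (fun i => q (i + m)) c := by
  obtain ⟨a, b, g, y, z, h, rfl, rfl, rfl⟩ := h
  refine ⟨a, b, fun t i => g t (i + m), fun t i => y t (i + m), fun t i => z t (i + m),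
    ⟨h.le, fun i => h.int _, fun i => h.int_sq _, fun i => h.cont _, fun i => h.mono _, ?_,
      fun t ht i => h.nonneg t ht _, fun i => h.compl _⟩, rfl, rfl, ?_⟩
  · intro t ht i
    rw [h.eq t ht (i + m), ← Equiv.sum_comp (Equiv.addRight m)]
    simp only [Equiv.coe_addRight, hR]
  · unfold energy
    rw [← Equiv.sum_comp (Equiv.addRight m) fun i => ∫ t in a..b, g t i ^ 2]
    simp only [Equiv.coe_addRight]

end

/-! ### Passing between Skorohod triples and elementary pieces -/

section

variable {d : ℕ} {R : Matrix (Fin d) (Fin d) ℝ}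

theorem normSq_one (v : Fin d → ℝ) : normSq 1 v = ∑ i, v i ^ 2 := by
  simp [normSq, dotProduct, pow_two]

theorem absolutelyContinuousOnInterval_apply {x : ℝ → Fin d → ℝ} {a b : ℝ}
    (h : AbsolutelyContinuousOnInterval x a b) (i : Fin d) :
    AbsolutelyContinuousOnInterval (fun t => x t i) a b := by
  refine squeeze_zero (fun E => Finset.sum_nonneg fun _ _ => dist_nonneg)
    (fun E => Finset.sum_le_sum fun j _ => ?_) h
  exact dist_le_pi_dist _ _ i

theorem absolutelyContinuousOnInterval_pi {x : ℝ → Fin d → ℝ} {a b : ℝ}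
    (h : ∀ i, AbsolutelyContinuousOnInterval (fun t => x t i) a b) :
    AbsolutelyContinuousOnInterval x a b := by
  have := tendsto_finsetSum Finset.univ fun i _ => h i
  simp only [Finset.sum_const_zero] at this
  refine squeeze_zero (fun E => Finset.sum_nonneg fun _ _ => dist_nonneg) (fun E => ?_) this
  rw [Finset.sum_comm]
  refine Finset.sum_le_sum fun j _ => ?_
  rw [dist_pi_le_iff (Finset.sum_nonneg fun _ _ => dist_nonneg)]
  intro i
  exact Finset.single_le_sum (f := fun i => dist (x (E.2 j).1 i) (x (E.2 j).2 i))
    (fun _ _ => dist_nonneg) (Finset.mem_univ i)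

theorem stieltjes_measure_Ioc {f : ℝ → ℝ} (hf : Monotone f) (hc : Continuous f) (s t : ℝ) :
    hf.stieltjesFunction.measure (Ioc s t) = ENNReal.ofReal (f t - f s) := by
  have : ∀ u, hf.stieltjesFunction u = f u := fun u => by
    rw [hf.stieltjesFunction_eq]
    exact rightLim_eq_of_tendsto (hc.tendsto u |>.mono_left nhdsWithin_le_nhds)
  rw [StieltjesFunction.measure_Ioc, this, this]

theorem IsRegulation.isPiece {θ : Fin d → ℝ} {x y z : ℝ → Fin d → ℝ} (hx : IsFiniteEnergyPath x)
    (h : IsRegulation R x y z) {T : ℝ} (hT : 0 ≤ T) :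
    IsPiece θ R 0 T (fun t => deriv x t - θ) y z ∧
      cost θ 1 x T = energy (fun t => deriv x t - θ) 0 T := by
  have hac : ∀ b, 0 < b → ∀ i, AbsolutelyContinuousOnInterval (fun t => x t i) 0 b :=
    fun b hb i => absolutelyContinuousOnInterval_apply (hx.ac b hb) i
  have hderiv : ∀ b, 0 ≤ b → ∀ i, (∀ᵐ t, t ∈ uIoc 0 b → deriv x t i = deriv (fun t => x t i) t) := by
    intro b hb i
    rcases hb.eq_or_lt with rfl | hb
    · simp
    have : ∀ᵐ t, ∀ j, t ∈ uIcc 0 b → DifferentiableAt ℝ (fun t => x t j) t :=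
      ae_all_iff.2 fun j => (hac b hb j).ae_differentiableAt
    filter_upwards [this] with t ht htm
    have h1 := fun j => (ht j (uIoc_subset_uIcc htm)).hasDerivAt
    rw [(hasDerivAt_pi.2 h1).deriv]
  have hmem : ∀ i, MemLp (fun t => deriv x t i) 2 (volume.restrict (Ioc 0 T)) := by
    intro i
    rcases hT.eq_or_lt with rfl | hT
    · simp
    exact (memLp_pi_iff.1 (hx.sq T hT)) i
  have hmem' : ∀ i, MemLp (fun t => deriv x t i - θ i) 2 (volume.restrict (Ioc 0 T)) :=
    fun i => (hmem i).sub (memLp_const _)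
  have hii : ∀ i, IntervalIntegrable (fun t => deriv x t i - θ i) volume 0 T := fun i => by
    rw [intervalIntegrable_iff_integrableOn_Ioc_of_le hT]
    exact (hmem' i).integrable (by norm_num)
  have hii2 : ∀ i, IntervalIntegrable (fun t => (deriv x t i - θ i) ^ 2) volume 0 T := fun i => by
    rw [intervalIntegrable_iff_integrableOn_Ioc_of_le hT]
    exact (hmem' i).integrable_sq
  have hxi : ∀ t ∈ Icc 0 T, ∀ i, x t i = t * θ i + ∫ s in (0 : ℝ)..t, (deriv x s i - θ i) := by
    intro t ht i
    have h2 : IntervalIntegrable (fun s => deriv x s i) volume 0 t := by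
      have := ((hii i).add (intervalIntegrable_const (c := θ i))).mono_set
        (c := 0) (d := t) (by rw [uIcc_of_le hT, uIcc_of_le ht.1]; exact Icc_subset_Icc_right ht.2)
      simpa using this
    rw [intervalIntegral.integral_sub h2 intervalIntegrable_const,
      intervalIntegral.integral_congr_ae (hderiv t ht.1 i)]
    rcases ht.1.eq_or_lt with rfl | ht0
    · simp [hx.zero]
    · rw [(hac t ht0 i).integral_deriv_eq_sub]
      simp [hx.zero]
  have hyc : ∀ i, Continuous fun t : ℝ => y (max t 0) i := fun i =>
    (continuous_apply i).comp (h.cont_y.comp_continuous (by fun_prop) fun t => le_max_right t 0)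
  refine ⟨⟨hT, hii, hii2, fun i => ?_, fun i s hs t ht hst => ?_, fun t ht i => ?_, fun t ht i => ?_,
    fun i s hs t ht hst hpos => ?_⟩, ?_⟩
  · exact ((continuous_apply i).comp_continuousOn h.cont_y).mono fun t ht => ht.1
  · have := h.mono i hst
    simpa [hs.1, ht.1] using this
  · rw [h.eq t ht.1, h.eq 0 le_rfl, h.y_zero, hx.zero]
    simp only [Pi.add_apply, hxi t ht i, Matrix.mulVec, dotProduct, Pi.zero_apply, sub_zero,
      Pi.sub_apply]
    simp
  · exact h.nonneg t ht.1 i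
  · have h0 := h.compl i
    -- On `[s, t]` the coordinate is bounded below by its positive minimum, so a vanishing integral
    -- against `dy_i` leaves no mass on `(s, t]`.
    have h1 : (h.mono i).stieltjesFunction.measure (Ioc s t) = 0 := by
      have hcz : ContinuousOn (fun r => z r i) (Icc s t) :=
        ((continuous_apply i).comp_continuousOn h.cont_z).mono fun r hr => hs.1.trans hr.1
      obtain ⟨m, hm, hmin⟩ := isCompact_Icc.exists_isMinOn (nonempty_Icc.2 hst) hcz
      have hmp := hpos m hm
      have h2 : ∫⁻ r in Ioc s t, ENNReal.ofReal (z m i) ∂(h.mono i).stieltjesFunction.measure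
          ≤ 0 := by
        rw [← h0]
        calc _ ≤ ∫⁻ r in Ioc s t, ENNReal.ofReal (z r i)
              ∂(h.mono i).stieltjesFunction.measure := by
              refine setLIntegral_mono' measurableSet_Ioc fun r hr => ?_
              exact ENNReal.ofReal_le_ofReal (hmin ⟨hr.1.le, hr.2⟩)
          _ ≤ _ := lintegral_mono_set fun r hr => hs.1.trans hr.1.le
      rw [setLIntegral_const] at h2
      have h3 := le_antisymm h2 bot_le
      rcases mul_eq_zero.1 h3 with h3 | h3
      · exact absurd (ENNReal.ofReal_eq_zero.1 h3) hmp.not_ge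
      · exact h3
    rw [stieltjes_measure_Ioc _ (hyc i), ENNReal.ofReal_eq_zero] at h1
    simp only [hs.1, ht.1, max_eq_left] at h1
    have := h.mono i hst
    simp only [hs.1, ht.1, max_eq_left] at this
    linarith
  · unfold cost energy
    simp only [normSq_one, Pi.sub_apply]
    rw [intervalIntegral.integral_finsetSum fun i _ => hii2 i]

/-- A feasible triple lives on `[0, ∞)`; the piece is prolonged by freezing all three paths after
`T`, which does not affect the cost on `[0, T]`. -/
theorem IsPiece.exists_isFeasible {θ : Fin d → ℝ} {g y z : ℝ → Fin d → ℝ} {T : ℝ}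
    (h : IsPiece θ R 0 T g y z) (hz0 : z 0 = 0) :
    ∃ x' y' z', IsFeasible R (z T) T x' y' z' ∧ (∀ t ∈ Icc 0 T, z' t = z t) ∧
      cost θ 1 x' T = energy g 0 T := by
  have hT := h.le
  -- The velocity of the unregulated path: the drift is added back to `g`, and the velocity is zero
  -- outside `(0, T]`.
  set F : ℝ → Fin d → ℝ := fun t i => (Ioc 0 T).indicator (fun t => θ i + g t i) t with hF
  set x' : ℝ → Fin d → ℝ := fun t i => ∫ s in (0 : ℝ)..t, F s i with hx'
  set c : ℝ → ℝ := fun t => min (max t 0) T with hc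
  have hcI : ∀ t, c t ∈ Icc 0 T := fun t => ⟨le_min (le_max_right _ _) hT, min_le_right _ _⟩
  have hcid : ∀ t ∈ Icc 0 T, c t = t := fun t ht => by simp [hc, ht.1, ht.2]
  have hcm : Monotone c := fun s t hst => min_le_min_right _ (max_le_max_right _ hst)
  have hcc : Continuous c := by fun_prop
  set y' : ℝ → Fin d → ℝ := fun t => y (c t) - y 0 with hy'
  set z' : ℝ → Fin d → ℝ := fun t => z (c t) with hz'
  have hgi : ∀ i, IntervalIntegrable (fun t => θ i + g t i) volume 0 T := fun i =>
    intervalIntegrable_const.add (h.int i)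
  have hFint : ∀ i, Integrable (fun t => F t i) := fun i => by
    have := (intervalIntegrable_iff_integrableOn_Ioc_of_le hT).1 (hgi i)
    exact (integrable_indicator_iff measurableSet_Ioc).2 this
  have hFL2 : ∀ i, MemLp (fun t => F t i) 2 := fun i => by
    have h1 : MemLp (fun t => g t i) 2 (volume.restrict (Ioc 0 T)) := by
      refine (memLp_two_iff_integrable_sq ?_).2 ?_
      · exact ((intervalIntegrable_iff_integrableOn_Ioc_of_le hT).1 (h.int i)).1
      · exact (intervalIntegrable_iff_integrableOn_Ioc_of_le hT).1 (h.int_sq i)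
    have h2 : MemLp (fun t => θ i + g t i) 2 (volume.restrict (Ioc 0 T)) :=
      MemLp.add (f := fun _ => θ i) (g := fun t => g t i) (memLp_const (θ i)) h1
    rw [← memLp_indicator_iff_restrict measurableSet_Ioc] at h2
    exact h2
  have hxc : Continuous x' := continuous_pi fun i =>
    intervalIntegral.continuous_primitive (fun a b => (hFint i).intervalIntegrable) 0
  have hzc : Continuous z' := continuous_pi fun i =>
    (h.continuousOn i).comp_continuous hcc hcI
  have hyc : Continuous y' := continuous_pi fun i =>
    ((h.cont i).comp_continuous hcc hcI).sub continuous_const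
  have hderiv : ∀ᵐ t, deriv x' t = F t := by
    have : ∀ᵐ t, ∀ i, HasDerivAt (fun t => x' t i) (F t i) t := ae_all_iff.2 fun i => by
      filter_upwards [LocallyIntegrable.ae_hasDerivAt_integral (hFint i).locallyIntegrable]
        with t ht using ht 0
    filter_upwards [this] with t ht
    exact (hasDerivAt_pi.2 ht).deriv
  have hx'T : ∀ t ∈ Icc 0 T, ∀ i, x' t i = t * θ i + ∫ s in (0 : ℝ)..t, g s i := by
    intro t ht i
    have h1 : x' t i = ∫ s in (0 : ℝ)..t, (θ i + g s i) := by
      refine intervalIntegral.integral_congr_ae (ae_of_all _ fun s hs => ?_)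
      rw [uIoc_of_le ht.1] at hs
      exact indicator_of_mem (show s ∈ Ioc 0 T from ⟨hs.1, hs.2.trans ht.2⟩) _
    rw [h1, intervalIntegral.integral_add intervalIntegrable_const
      (h.int_of_mem ⟨le_rfl, hT⟩ ht i)]
    simp
  have hx'c : ∀ t, 0 ≤ t → x' t = x' (c t) := by
    intro t ht
    rcases le_total t T with htT | htT
    · rw [hcid t ⟨ht, htT⟩]
    · have : c t = T := by simp [hc, ht, htT]
      rw [this]
      funext i
      have h1 : ∫ s in T..t, F s i = 0 := by
        rw [intervalIntegral.integral_congr_ae (g := fun _ => 0) (ae_of_all _ fun s hs => ?_)]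
        · simp
        · rw [uIoc_of_le htT] at hs
          exact indicator_of_notMem (fun hm => hs.1.not_ge hm.2) _
      simp only [hx']
      rw [← intervalIntegral.integral_add_adjacent_intervals
        ((hFint i).intervalIntegrable (a := 0) (b := T)) (hFint i).intervalIntegrable, h1, add_zero]
  have hmono : ∀ i, Monotone fun t : ℝ => y' (max t 0) i := fun i s t hst => by
    simp only [hy', Pi.sub_apply]
    have := h.mono i (hcI _) (hcI _) (hcm (max_le_max_right 0 hst))
    simp only at this
    linarith
  have hpath : IsFiniteEnergyPath x' := by
    refine ⟨by funext i; simp [hx'], fun S hS => ?_, fun S hS => ?_⟩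
    · refine absolutelyContinuousOnInterval_pi fun i => ?_
      exact ((hFint i).intervalIntegrable).absolutelyContinuousOnInterval_intervalIntegral
        (by simp)
    · refine MemLp.ae_eq (f := F) ?_ (memLp_pi_iff.2 fun i => (hFL2 i).restrict _)
      exact ae_restrict_of_ae (hderiv.mono fun t ht => ht.symm)
  refine ⟨x', y', z', ⟨hpath, ⟨hxc.continuousOn, hyc.continuousOn, hzc.continuousOn, ?_, ?_, hmono,
    ?_, ?_⟩, hT, by simp only [hz']; rw [hcid T ⟨hT, le_rfl⟩]⟩,
    fun t ht => by simp only [hz']; rw [hcid t ht], ?_⟩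
  · intro t ht
    rw [hx'c t ht]
    funext i
    simp only [hz', Pi.add_apply]
    rw [h.eq _ (hcI t) i, hx'T _ (hcI t), hz0]
    simp [Matrix.mulVec, dotProduct, hy']
  · intro t _ i
    exact h.nonneg _ (hcI t) i
  · simp [hy', hc, hT]
  · intro i
    have hyc' : Continuous fun t : ℝ => y' (max t 0) i := by fun_prop
    have hzi : Continuous fun t => z' t i := by fun_prop
    refine (lintegral_eq_zero_iff (f := fun t => ENNReal.ofReal (z' t i))
      (ENNReal.measurable_ofReal.comp hzi.measurable)).2 ?_
    rw [Filter.EventuallyEq, ae_restrict_iff' measurableSet_Ici, ae_iff]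
    have hsub : {t | ¬(t ∈ Ici (0 : ℝ) → ENNReal.ofReal (z' t i) = (0 : ℝ → ENNReal) t)} ⊆
        {t | 0 < z' t i} := by
      intro t ht
      simp only [Classical.not_imp, mem_ofPred_eq, Pi.zero_apply, ENNReal.ofReal_eq_zero,
        not_le] at ht
      exact ht.2
    -- Since `{z' i > 0}` is open, it is enough that `dy'_i` gives no mass to a small interval
    -- around each of its points.
    refine measure_mono_null hsub (measure_null_of_locally_null _ fun t ht => ?_)
    have ho : IsOpen {t | 0 < z' t i} := isOpen_lt continuous_const hzi
    obtain ⟨ε, hε, hb⟩ := Metric.isOpen_iff.1 ho t ht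
    refine ⟨Ioc (t - ε / 2) (t + ε / 2), mem_nhdsWithin_of_mem_nhds
      (Ioc_mem_nhds (by linarith) (by linarith)), ?_⟩
    rw [stieltjes_measure_Ioc _ hyc', ENNReal.ofReal_eq_zero]
    simp only [hy', Pi.sub_apply]
    have hle : max (t - ε / 2) 0 ≤ max (t + ε / 2) 0 := max_le_max_right 0 (by linarith)
    rw [h.compl i _ (hcI _) _ (hcI _) (hcm hle) ?_]
    · simp
    · intro r hr
      obtain ⟨u, hu, hur⟩ : ∃ u ∈ Icc (t - ε / 2) (t + ε / 2), c u = r := by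
        have := intermediate_value_Icc (show t - ε / 2 ≤ t + ε / 2 by linarith) hcc.continuousOn
        have hcmax : ∀ u, c (max u 0) = c u := fun u => by simp [hc]
        rw [hcmax, hcmax] at hr
        obtain ⟨u, hu, hur⟩ := this hr
        exact ⟨u, hu, hur⟩
      have : u ∈ Metric.ball t ε := by
        rw [Metric.mem_ball, Real.dist_eq, abs_lt]
        constructor <;> linarith [hu.1, hu.2]
      have h3 := hb this
      simp only [mem_ofPred_eq, hz', hur] at h3
      exact h3
  · unfold cost energy
    simp only [normSq_one, Pi.sub_apply]
    rw [← intervalIntegral.integral_finsetSum fun i _ => h.int_sq i]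
    congr 1
    refine intervalIntegral.integral_congr_ae (hderiv.mono fun t ht htm => ?_)
    rw [uIoc_of_le hT] at htm
    refine Finset.sum_congr rfl fun i _ => ?_
    rw [ht]
    simp [hF, htm]

theorem value_le_of_reach {θ v : Fin d → ℝ} {c : ℝ} (h : Reach θ R 0 v c) :
    value θ 1 R v ≤ c := by
  obtain ⟨a, b, g, y, z, h, hz0, rfl, rfl⟩ := h
  obtain ⟨h1, h2⟩ := h.affine_time one_pos (-a)
  simp only [one_mul, add_neg_cancel, div_one, one_smul, sub_neg_eq_add] at h1 h2
  obtain ⟨x', y', z', hf, -, hcost⟩ := h1.exists_isFeasible (by simpa using hz0)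
  rw [← h2, ← hcost]
  refine csInf_le ⟨0, ?_⟩ ⟨_, x', y', z', by simpa using hf, rfl⟩
  rintro _ ⟨T, x, y, z, hf, rfl⟩
  unfold cost
  refine mul_nonneg (by norm_num) (intervalIntegral.integral_nonneg hf.time_nonneg fun t _ => ?_)
  rw [normSq_one]
  positivity

end

/-! ### Cauchy–Schwarz, perturbation and straightening of pieces -/

section

theorem integral_affine_sq {f : ℝ → ℝ} {s t : ℝ} (hf : IntervalIntegrable f volume s t)
    (hf2 : IntervalIntegrable (fun r => f r ^ 2) volume s t) (u w : ℝ) :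
    IntervalIntegrable (fun r => (u * f r + w) ^ 2) volume s t ∧
    ∫ r in s..t, (u * f r + w) ^ 2 =
      u ^ 2 * (∫ r in s..t, f r ^ 2) + 2 * u * w * (∫ r in s..t, f r) + w ^ 2 * (t - s) := by
  have e : (fun r => (u * f r + w) ^ 2) =
      fun r => u ^ 2 * f r ^ 2 + 2 * u * w * f r + w ^ 2 := by funext r; ring
  have h1 := hf2.const_mul (u ^ 2)
  have h2 := hf.const_mul (2 * u * w)
  have h3 : IntervalIntegrable (fun _ : ℝ => w ^ 2) volume s t := intervalIntegrable_const
  rw [e]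
  refine ⟨(h1.add h2).add h3, ?_⟩
  rw [intervalIntegral.integral_add (h1.add h2) h3, intervalIntegral.integral_add h1 h2]
  simp
  ring

theorem sq_integral_le {f : ℝ → ℝ} {s t : ℝ} (hst : s ≤ t) (hf : IntervalIntegrable f volume s t)
    (hf2 : IntervalIntegrable (fun r => f r ^ 2) volume s t) :
    (∫ r in s..t, f r) ^ 2 ≤ (t - s) * ∫ r in s..t, f r ^ 2 := by
  rcases hst.eq_or_lt with rfl | hlt
  · simp
  have h0 : 0 ≤ ∫ r in s..t, ((t - s) * f r + -(∫ r in s..t, f r)) ^ 2 :=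
    intervalIntegral.integral_nonneg hst fun _ _ => sq_nonneg _
  rw [(integral_affine_sq hf hf2 _ _).2] at h0
  have h1 : 0 < t - s := sub_pos.2 hlt
  have h2 : 0 ≤ (t - s) * ((t - s) * (∫ r in s..t, f r ^ 2) - (∫ r in s..t, f r) ^ 2) := by
    nlinarith
  have := nonneg_of_mul_nonneg_right h2 h1
  linarith

/-- The equality case of the Cauchy-Schwarz inequality `sq_integral_le`. -/
theorem integral_affine_of_le_sq {f : ℝ → ℝ} {s t r : ℝ} (hr : r ∈ Icc s t)
    (hf : IntervalIntegrable f volume s t)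
    (hf2 : IntervalIntegrable (fun r => f r ^ 2) volume s t)
    (h : (t - s) * (∫ r in s..t, f r ^ 2) ≤ (∫ r in s..t, f r) ^ 2) :
    (t - s) * (∫ u in s..r, f u) = (r - s) * ∫ u in s..t, f u := by
  have hst := hr.1.trans hr.2
  have hs1 : uIcc s r ⊆ uIcc s t := by
    rw [uIcc_of_le hr.1, uIcc_of_le hst]; exact Icc_subset_Icc_right hr.2
  have hs2 : uIcc r t ⊆ uIcc s t := by
    rw [uIcc_of_le hr.2, uIcc_of_le hst]; exact Icc_subset_Icc_left hr.1
  rw [← intervalIntegral.integral_add_adjacent_intervals (hf.mono_set hs1) (hf.mono_set hs2)]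
    at h ⊢
  rw [← intervalIntegral.integral_add_adjacent_intervals (hf2.mono_set hs1)
    (hf2.mono_set hs2)] at h
  have h1 := sq_integral_le hr.1 (hf.mono_set hs1) (hf2.mono_set hs1)
  have h2 := sq_integral_le hr.2 (hf.mono_set hs2) (hf2.mono_set hs2)
  generalize (∫ u in s..r, f u) = P at *
  generalize (∫ u in r..t, f u) = Q at *
  generalize (∫ u in s..r, f u ^ 2) = A at *
  generalize (∫ u in r..t, f u ^ 2) = B at *
  obtain ⟨a, ha⟩ : ∃ a, a = r - s := ⟨_, rfl⟩
  obtain ⟨b, hb⟩ : ∃ b, b = t - r := ⟨_, rfl⟩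
  have hts : t - s = a + b := by rw [ha, hb]; ring
  have ha0 : 0 ≤ a := by rw [ha]; linarith [hr.1]
  have hb0 : 0 ≤ b := by rw [hb]; linarith [hr.2]
  rw [hts] at h ⊢
  rw [← ha] at h1 ⊢
  rw [← hb] at h2
  have h3 := mul_le_mul_of_nonneg_left h1 (mul_nonneg (add_nonneg ha0 hb0) hb0)
  have h4 := mul_le_mul_of_nonneg_left h2 (mul_nonneg (add_nonneg ha0 hb0) ha0)
  have h5 := mul_le_mul_of_nonneg_left h (mul_nonneg ha0 hb0)
  -- Equality on the whole interval forces equal means on the two parts: the defect in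
  -- Cauchy–Schwarz for the two-point average is this square.
  have h6 : (b * P - a * Q) ^ 2 ≤ 0 := by nlinarith
  have h7 : b * P - a * Q = 0 := pow_eq_zero_iff (two_ne_zero) |>.1 (le_antisymm h6 (sq_nonneg _))
  linarith

theorem exists_last_zero {f : ℝ → ℝ} {s r : ℝ} (hsr : s ≤ r) (hf : ContinuousOn f (Icc s r))
    (h0 : ∀ t ∈ Icc s r, 0 ≤ f t) (hs : f s = 0) (hr : 0 < f r) :
    ∃ a ∈ Ico s r, f a = 0 ∧ ∀ t ∈ Ioc a r, 0 < f t := by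
  set S : Set ℝ := {t ∈ Icc s r | f t = 0} with hS
  have hcl : IsClosed S := by
    have := hf.preimage_isClosed_of_isClosed isClosed_Icc (isClosed_singleton (x := (0 : ℝ)))
    exact this
  have hcomp : IsCompact S := isCompact_Icc.of_isClosed_subset hcl fun t ht => ht.1
  have hne : S.Nonempty := ⟨s, ⟨le_rfl, hsr⟩, hs⟩
  have hm := hcomp.sSup_mem hne
  have hle : ∀ t ∈ S, t ≤ sSup S := fun t ht => le_csSup hcomp.bddAbove ht
  refine ⟨sSup S, ⟨hm.1.1, hm.1.2.lt_of_ne fun h => ?_⟩, hm.2, fun t ht => ?_⟩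
  · rw [← h, hm.2] at hr; exact lt_irrefl _ hr
  · have htI : t ∈ Icc s r := ⟨hm.1.1.trans ht.1.le, ht.2⟩
    refine (h0 t htI).lt_of_ne fun h => ?_
    exact (hle t ⟨htI, h.symm⟩).not_gt ht.1

theorem exists_first_zero {f : ℝ → ℝ} {r t : ℝ} (hrt : r ≤ t) (hf : ContinuousOn f (Icc r t))
    (h0 : ∀ u ∈ Icc r t, 0 ≤ f u) (hr : 0 < f r) (ht : f t = 0) :
    ∃ b ∈ Ioc r t, f b = 0 ∧ ∀ u ∈ Ico r b, 0 < f u := by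
  have hmap : ∀ u ∈ Icc (-t) (-r), -u ∈ Icc r t := fun u hu =>
    ⟨by linarith [hu.2], by linarith [hu.1]⟩
  obtain ⟨a, ha, ha0, hpos⟩ := exists_last_zero (f := fun u => f (-u)) (s := -t) (r := -r)
    (by linarith) (hf.comp (by fun_prop) hmap) (fun u hu => h0 _ (hmap u hu)) (by simpa using ht)
    (by simpa using hr)
  refine ⟨-a, ⟨by linarith [ha.2], by linarith [ha.1]⟩, ha0, fun u hu => ?_⟩
  have := hpos (-u) ⟨by linarith [hu.2], by linarith [hu.1]⟩
  simpa using this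

variable {d : ℕ} {θ : Fin d → ℝ} {R : Matrix (Fin d) (Fin d) ℝ} {a b s t : ℝ}
  {g y z : ℝ → Fin d → ℝ}

/-- Complementarity needs positivity on a closed interval; continuity of `y i` extends it to
endpoints at which `z i` may vanish. -/
theorem IsPiece.y_eq_of_pos (h : IsPiece θ R a b g y z) (hab : a < b) {i : Fin d}
    (hpos : ∀ r ∈ Ioo a b, 0 < z r i) (hs : s ∈ Icc a b) (ht : t ∈ Icc a b) :
    y s i = y t i := by
  set m := (a + b) / 2 with hm
  have hmI : m ∈ Ioo a b := ⟨by rw [hm]; linarith, by rw [hm]; linarith⟩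
  have key : EqOn (fun r => y r i) (fun _ => y m i) (Icc a b) := by
    refine EqOn.of_subset_closure (s := Ioo a b) (fun r hr => ?_) (h.cont i) continuousOn_const
      Ioo_subset_Icc_self (by rw [closure_Ioo hab.ne])
    rcases le_total r m with hrm | hrm
    · exact (h.compl i r (Ioo_subset_Icc_self hr) m (Ioo_subset_Icc_self hmI) hrm fun u hu =>
        hpos u ⟨hr.1.trans_le hu.1, hu.2.trans_lt hmI.2⟩).symm
    · exact h.compl i m (Ioo_subset_Icc_self hmI) r (Ioo_subset_Icc_self hr) hrm fun u hu =>
        hpos u ⟨hmI.1.trans_le hu.1, hu.2.trans_lt hr.2⟩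
  exact (key hs).trans (key ht).symm

/-- Replacing `g i` by `u * g i + w` while `z i` is positive. -/
theorem IsPiece.reach_perturb (h : IsPiece θ R a b g y z) {i : Fin d}
    (hpos : ∀ r ∈ Icc a b, 0 < z r i) (u w : ℝ)
    (hpos' : ∀ r ∈ Icc a b, 0 ≤ z r i + ((u - 1) * (∫ v in a..r, g v i) + w * (r - a))) :
    Reach θ R (z a)
      (Function.update (z b) i (z b i + ((u - 1) * (∫ v in a..b, g v i) + w * (b - a))))
      (energy g a b + 1 / 2 * ((u ^ 2 - 1) * (∫ v in a..b, g v i ^ 2) +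
        2 * u * w * (∫ v in a..b, g v i) + w ^ 2 * (b - a))) := by
  have hy : ∀ s ∈ Icc a b, ∀ t ∈ Icc a b, y t i = y s i := by
    intro s hs t ht
    rcases h.le.eq_or_lt with hab | hab
    · rw [le_antisymm (hs.2.trans (hab ▸ ht.1)) (ht.2.trans (hab ▸ hs.1))]
    · exact h.y_eq_of_pos hab (fun r hr => hpos r (Ioo_subset_Icc_self hr)) ht hs
  set g' : ℝ → Fin d → ℝ := fun t => Function.update (g t) i (u * g t i + w) with hg'
  set z' : ℝ → Fin d → ℝ := fun t => Function.update (z t) i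
    (z t i + ((u - 1) * (∫ v in a..t, g v i) + w * (t - a))) with hz'
  have hgi : ∀ t, g' t i = u * g t i + w := fun t => by simp [hg']
  have hgj : ∀ t j, j ≠ i → g' t j = g t j := fun t j hj => by simp [hg', hj]
  have hzi : ∀ t, z' t i = z t i + ((u - 1) * (∫ v in a..t, g v i) + w * (t - a)) :=
    fun t => by simp [hz']
  have hzj : ∀ t j, j ≠ i → z' t j = z t j := fun t j hj => by simp [hz', hj]
  have hza : z' a = z a := by
    funext j
    by_cases hj : j = i
    · subst hj; simp [hzi]
    · exact hzj a j hj
  have hint : ∀ t ∈ Icc a b, ∫ v in a..t, (u * g v i + w) =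
      u * (∫ v in a..t, g v i) + w * (t - a) := by
    intro t ht
    rw [intervalIntegral.integral_add
      ((h.int_of_mem ⟨le_rfl, h.le⟩ ht i).const_mul u) intervalIntegrable_const]
    simp [mul_comm]
  have hP : IsPiece θ R a b g' y z' := by
    refine ⟨h.le, fun j => ?_, fun j => ?_, h.cont, h.mono, fun t ht j => ?_, fun t ht j => ?_,
      fun j s hs t ht hst hp => ?_⟩
    · by_cases hj : j = i
      · subst hj; simp only [hgi]
        exact ((h.int j).const_mul u).add intervalIntegrable_const
      · simp only [hgj _ j hj]; exact h.int j
    · by_cases hj : j = i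
      · subst hj; simp only [hgi]
        exact (integral_affine_sq (h.int j) (h.int_sq j) u w).1
      · simp only [hgj _ j hj]; exact h.int_sq j
    · rw [hza]
      by_cases hj : j = i
      · subst hj
        simp only [hgi, hzi]
        rw [hint t ht, h.eq t ht j]
        ring
      · simp only [hgj _ j hj, hzj _ j hj]
        exact h.eq t ht j
    · by_cases hj : j = i
      · subst hj; simp only [hzi]; exact hpos' t ht
      · simp only [hzj _ j hj]; exact h.nonneg t ht j
    · by_cases hj : j = i
      · subst hj; exact hy s hs t ht
      · simp only [hzj _ j hj] at hp; exact h.compl j s hs t ht hst hp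
  refine ⟨a, b, g', y, z', hP, hza, rfl, ?_⟩
  unfold energy
  rw [← mul_add]
  congr 1
  rw [← Finset.add_sum_erase _ _ (Finset.mem_univ i),
    ← Finset.add_sum_erase _ (fun j => ∫ t in a..b, g t j ^ 2) (Finset.mem_univ i)]
  have : ∑ j ∈ Finset.univ.erase i, ∫ t in a..b, g' t j ^ 2 =
      ∑ j ∈ Finset.univ.erase i, ∫ t in a..b, g t j ^ 2 :=
    Finset.sum_congr rfl fun j hj => by simp only [hgj _ j (Finset.ne_of_mem_erase hj)]
  rw [this]
  simp only [hgi]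
  rw [(integral_affine_sq (h.int i) (h.int_sq i) u w).2]
  ring

/-- A path may be straightened if each coordinate is unregulated or stays at zero. -/
theorem IsPiece.straighten (h : IsPiece θ R a b g y z) (hab : a < b)
    (hK : ∀ i, y b i = y a i ∨ ∀ r ∈ Icc a b, z r i = 0) :
    IsPiece θ R a b (fun _ i => (∫ v in a..b, g v i) / (b - a))
      (fun t => y a + ((t - a) / (b - a)) • (y b - y a))
      (fun t => z a + ((t - a) / (b - a)) • (z b - z a)) := by
  have hba : 0 < b - a := sub_pos.2 hab
  have ha : a ∈ Icc a b := ⟨le_rfl, hab.le⟩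
  have hb : b ∈ Icc a b := ⟨hab.le, le_rfl⟩
  refine ⟨hab.le, fun i => intervalIntegrable_const, fun i => intervalIntegrable_const,
    fun i => ?_, fun i s hs t ht hst => ?_, fun t ht i => ?_, fun t ht i => ?_,
    fun i s hs t ht hst hp => ?_⟩
  · simp only [Pi.add_apply, Pi.smul_apply]
    fun_prop
  · simp only [Pi.add_apply, Pi.smul_apply, Pi.sub_apply, smul_eq_mul]
    have := h.mono i ha hb hab.le
    simp only at this
    have h1 : 0 ≤ y b i - y a i := sub_nonneg.2 this
    have : (s - a) / (b - a) ≤ (t - a) / (b - a) := by gcongr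
    linarith [mul_le_mul_of_nonneg_right this h1]
  · simp only [Pi.add_apply, Pi.smul_apply, Pi.sub_apply, smul_eq_mul, sub_self, zero_div,
      zero_mul, add_zero, intervalIntegral.integral_const, add_sub_cancel_left]
    rw [h.increment ha hb i]
    have : ∑ j, R i j * ((t - a) / (b - a) * (y b j - y a j)) =
        (t - a) / (b - a) * ∑ j, R i j * (y b j - y a j) := by
      rw [Finset.mul_sum]
      exact Finset.sum_congr rfl fun j _ => by ring
    rw [this]
    field_simp
    ring
  · simp only [Pi.add_apply, Pi.smul_apply, Pi.sub_apply, smul_eq_mul]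
    have h1 := h.nonneg a ha i
    have h2 := h.nonneg b hb i
    have h3 : 0 ≤ (t - a) / (b - a) := div_nonneg (sub_nonneg.2 ht.1) hba.le
    have h4 : (t - a) / (b - a) ≤ 1 := by
      rw [div_le_one hba]; linarith [ht.2]
    nlinarith
  · rcases hK i with hK | hK
    · simp [hK]
    · have := hp s ⟨le_rfl, hst⟩
      simp [hK a ha, hK b hb] at this

theorem energy_const (c : Fin d → ℝ) (hab : a < b) :
    energy (fun _ i => c i / (b - a)) a b = 1 / 2 * ∑ i, c i ^ 2 / (b - a) := by
  have hba : b - a ≠ 0 := (sub_pos.2 hab).ne'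
  unfold energy
  congr 1
  refine Finset.sum_congr rfl fun i _ => ?_
  simp only [intervalIntegral.integral_const, smul_eq_mul]
  field_simp

theorem energy_straighten_le (h : IsPiece θ R a b g y z) (hab : a < b) :
    energy (fun _ i => (∫ v in a..b, g v i) / (b - a)) a b ≤ energy g a b := by
  rw [energy_const (fun i => ∫ v in a..b, g v i) hab]
  unfold energy
  gcongr with i
  rw [div_le_iff₀ (sub_pos.2 hab), mul_comm]
  exact sq_integral_le hab.le (h.int i) (h.int_sq i)

/-- Equality in Cauchy–Schwarz makes the primitive of `g` affine. If `e` is the deviation of `y`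
from its chord, then `R e` is the deviation of `z` from its chord. In each coordinate either `e i =
0` (no regulation) or `(R e) i = 0` (`z i` stays at zero), so `e ⬝ R e = 0`, hence `e = 0` and `z`
equals its chord. -/
theorem IsPiece.isLinearOn (h : IsPiece θ R a b g y z) (hab : a < b)
    (hR : ∀ e : Fin d → ℝ, (∑ i, e i * ∑ j, R i j * e j) = 0 → e = 0)
    (hK : ∀ i, y b i = y a i ∨ ∀ r ∈ Icc a b, z r i = 0)
    (hE : energy g a b ≤ energy (fun _ i => (∫ v in a..b, g v i) / (b - a)) a b) :
    IsLinearOn z a b := by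
  have hba : 0 < b - a := sub_pos.2 hab
  have ha : a ∈ Icc a b := ⟨le_rfl, hab.le⟩
  have hb : b ∈ Icc a b := ⟨hab.le, le_rfl⟩
  have hle : ∀ i, (∫ v in a..b, g v i) ^ 2 / (b - a) ≤ ∫ v in a..b, g v i ^ 2 := fun i => by
    rw [div_le_iff₀ hba, mul_comm]
    exact sq_integral_le hab.le (h.int i) (h.int_sq i)
  have heq : ∀ i, ∫ v in a..b, g v i ^ 2 ≤ (∫ v in a..b, g v i) ^ 2 / (b - a) := by
    rw [energy_const (fun i => ∫ v in a..b, g v i) hab] at hE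
    unfold energy at hE
    have h1 : ∑ i, ∫ v in a..b, g v i ^ 2 ≤ ∑ i, (∫ v in a..b, g v i) ^ 2 / (b - a) := by linarith
    intro i
    exact ((Finset.sum_eq_sum_iff_of_le fun i _ => hle i).1
      (le_antisymm (Finset.sum_le_sum fun i _ => hle i) h1) i (Finset.mem_univ i)).ge
  have hint : ∀ i, ∀ r ∈ Icc a b,
      ∫ v in a..r, g v i = (r - a) / (b - a) * ∫ v in a..b, g v i := by
    intro i r hr
    have h2 := heq i
    rw [le_div_iff₀ hba] at h2
    have := integral_affine_of_le_sq hr (h.int i) (h.int_sq i) (by linarith)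
    field_simp
    linarith
  have hzz : ∀ r ∈ Icc a b, ∀ i, z r i - (z a i + (r - a) / (b - a) * (z b i - z a i)) =
      ∑ j, R i j * ((y r j - y a j) - (r - a) / (b - a) * (y b j - y a j)) := by
    intro r hr i
    have : ∑ j, R i j * ((y r j - y a j) - (r - a) / (b - a) * (y b j - y a j)) =
        ∑ j, R i j * (y r j - y a j) - (r - a) / (b - a) * ∑ j, R i j * (y b j - y a j) := by
      rw [Finset.mul_sum, ← Finset.sum_sub_distrib]
      exact Finset.sum_congr rfl fun j _ => by ring
    rw [this, h.eq r hr i, h.eq b hb i, hint i r hr]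
    field_simp
    ring
  refine ⟨z a - (a / (b - a)) • (z b - z a), (1 / (b - a)) • (z b - z a), fun r hr => ?_⟩
  have he : (fun j => (y r j - y a j) - (r - a) / (b - a) * (y b j - y a j)) = 0 := by
    refine hR _ (Finset.sum_eq_zero fun i _ => ?_)
    rcases hK i with hK | hK
    · have h1 := h.mono i ha hr hr.1
      have h2 := h.mono i hr hb hr.2
      simp only [hK] at h1 h2
      rw [le_antisymm h2 h1, hK]
      ring
    · rw [← hzz r hr i, hK r hr, hK a ha, hK b hb]
      ring
  funext i
  have h1 := hzz r hr i
  have h2 : ∑ j, R i j * ((y r j - y a j) - (r - a) / (b - a) * (y b j - y a j)) = 0 :=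
    Finset.sum_eq_zero fun j _ => by
      have := congrFun he j
      simp only [Pi.zero_apply] at this
      rw [this, mul_zero]
  rw [h2] at h1
  simp only [Pi.add_apply, Pi.sub_apply, Pi.smul_apply, smul_eq_mul]
  have : z r i = z a i + (r - a) / (b - a) * (z b i - z a i) := by linarith
  rw [this]
  field_simp
  ring

end

/-! ### First-order conditions along an optimal path -/

section

variable {d : ℕ} {θ : Fin d → ℝ} {R : Matrix (Fin d) (Fin d) ℝ} {a b s t T : ℝ}
  {g y z : ℝ → Fin d → ℝ}

/-- A path on `[0, T]` of minimal cost among those from the origin to its terminal point. -/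
structure IsOpt (θ : Fin d → ℝ) (R : Matrix (Fin d) (Fin d) ℝ) (T : ℝ) (g y z : ℝ → Fin d → ℝ) :
    Prop where
  piece : IsPiece θ R 0 T g y z
  zero : z 0 = 0
  opt : ∀ c, Reach θ R 0 (z T) c → energy g 0 T ≤ c

/-- The principle of optimality: a cheaper middle piece could be spliced into the whole path. -/
theorem IsOpt.energy_le (h : IsOpt θ R T g y z) (hs : s ∈ Icc 0 T) (ht : t ∈ Icc 0 T)
    (hst : s ≤ t) {c : ℝ} (hc : Reach θ R (z s) (z t) c) : energy g s t ≤ c := by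
  have h0 : (0 : ℝ) ∈ Icc 0 T := ⟨le_rfl, h.piece.le⟩
  have hT : T ∈ Icc 0 T := ⟨h.piece.le, le_rfl⟩
  have h1 := (h.piece.restrict h0 hs hs.1).reach
  have h2 := (h.piece.restrict ht hT ht.2).reach
  rw [h.zero] at h1
  have h3 := h.opt _ ((h1.trans hc).trans h2)
  rw [energy_add h.piece ht, energy_add (h.piece.restrict h0 ht ht.1) ⟨hs.1, hst⟩] at h3
  linarith

theorem affine_on_closure {G : ℝ → ℝ} (hab : a < b) (hG : ContinuousOn G (Icc a b))
    (h : ∀ s t, a < s → s < t → t < b → ∀ r ∈ Icc s t,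
      (t - s) * (G r - G s) = (r - s) * (G t - G s)) :
    ∀ r ∈ Icc a b, (b - a) * (G r - G a) = (r - a) * (G b - G a) := by
  have key : ∀ r ∈ Ioo a b, (b - a) * (G r - G a) = (r - a) * (G b - G a) := by
    intro r hr
    have h1 : ∀ t ∈ Ioo r b, ∀ s ∈ Ioo a r, (t - s) * (G r - G s) = (r - s) * (G t - G s) :=
      fun t ht s hs => h s t hs.1 (hs.2.trans ht.1) ht.2 r ⟨hs.2.le, ht.1.le⟩
    have hca : ContinuousOn G (Icc a r) := hG.mono (Icc_subset_Icc_right hr.2.le)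
    have hcb : ContinuousOn G (Icc r b) := hG.mono (Icc_subset_Icc_left hr.1.le)
    have h2 : ∀ t ∈ Ioo r b, (t - a) * (G r - G a) = (r - a) * (G t - G a) := by
      intro t ht
      have : EqOn (fun s => (t - s) * (G r - G s)) (fun s => (r - s) * (G t - G s)) (Icc a r) :=
        EqOn.of_subset_closure (s := Ioo a r) (fun s hs => h1 t ht s hs) (by fun_prop)
          (by fun_prop) Ioo_subset_Icc_self (by rw [closure_Ioo hr.1.ne])
      exact this ⟨le_rfl, hr.1.le⟩
    have : EqOn (fun t => (t - a) * (G r - G a)) (fun t => (r - a) * (G t - G a)) (Icc r b) :=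
      EqOn.of_subset_closure (s := Ioo r b) (fun t ht => h2 t ht) (by fun_prop)
        (by fun_prop) Ioo_subset_Icc_self (by rw [closure_Ioo hr.2.ne])
    exact this ⟨hr.2.le, le_rfl⟩
  intro r hr
  rcases hr.1.eq_or_lt with rfl | h1
  · simp
  rcases hr.2.eq_or_lt with rfl | h2
  · ring
  exact key r ⟨h1, h2⟩

/-- While `z i` is positive, the momentum `g i` of an optimal path is constant. -/
theorem IsOpt.exists_slope (h : IsOpt θ R T g y z) (ha : 0 ≤ a) (hab : a < b) (hb : b ≤ T)
    {i : Fin d} (hpos : ∀ r ∈ Ioo a b, 0 < z r i) :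
    ∃ m : ℝ, ∀ s ∈ Icc a b, ∀ t ∈ Icc a b, ∫ v in s..t, g v i = m * (t - s) := by
  have hsub : Icc a b ⊆ Icc 0 T := Icc_subset_Icc ha hb
  have hPab := h.piece.restrict (hsub ⟨le_rfl, hab.le⟩) (hsub ⟨hab.le, le_rfl⟩) hab.le
  have hab0 : 0 < b - a := sub_pos.2 hab
  have key : ∀ s t, a < s → s < t → t < b → ∀ r ∈ Icc s t,
      (t - s) * (∫ v in s..r, g v i) = (r - s) * ∫ v in s..t, g v i := by
    intro s t has hst htb
    have hsI : s ∈ Icc 0 T := hsub ⟨has.le, (hst.trans htb).le⟩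
    have htI : t ∈ Icc 0 T := hsub ⟨(has.trans hst).le, htb.le⟩
    have hP := h.piece.restrict hsI htI hst.le
    have hts : 0 < t - s := sub_pos.2 hst
    have hp : ∀ r ∈ Icc s t, 0 < z r i := fun r hr =>
      hpos r ⟨has.trans_le hr.1, hr.2.trans_lt htb⟩
    set m := (∫ v in s..t, g v i) / (t - s) with hm
    have hmi : ∫ v in s..t, g v i = m * (t - s) := by rw [hm]; field_simp
    have hcP : ContinuousOn (fun r => ∫ v in s..r, g v i) (Icc s t) := by
      have := intervalIntegral.continuousOn_primitive_interval (μ := volume)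
        (f := fun r => g r i) (a := s) (b := t) (by
          rw [uIcc_of_le hst.le]
          exact (intervalIntegrable_iff_integrableOn_Icc_of_le hst.le).1 (hP.int i))
      rwa [uIcc_of_le hst.le] at this
    obtain ⟨r₀, hr₀, hmin⟩ := isCompact_Icc.exists_isMinOn (nonempty_Icc.2 hst.le)
      (hP.continuousOn i)
    obtain ⟨M, hM⟩ := isCompact_Icc.exists_bound_of_continuousOn
      (f := fun r => m * (r - s) - ∫ v in s..r, g v i) (s := Icc s t)
      (ContinuousOn.sub (by fun_prop) hcP)
    have hδ := hp r₀ hr₀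
    set δ := z r₀ i with hδd
    have hM0 : 0 ≤ M := (norm_nonneg _).trans (hM s ⟨le_rfl, hst.le⟩)
    -- `g i` is moved the fraction `l` towards its mean `m`. This keeps the endpoint, and `l * M ≤
    -- δ` keeps `z i` nonnegative, where `δ` is the minimum of `z i` and `M` bounds the displacement
    -- for `l = 1`. Optimality then forces equality in Cauchy–Schwarz.
    set l := δ / (M + δ) with hl
    have hl0 : 0 < l := by positivity
    have hl1 : l ≤ 1 := by rw [hl, div_le_one (by positivity)]; linarith
    have hlM : l * M ≤ δ := by
      rw [hl, div_mul_eq_mul_div, div_le_iff₀ (by positivity)]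
      nlinarith
    have hR := hP.reach_perturb hp (1 - l) (l * m) fun r hr => by
      have h1 : δ ≤ z r i := hmin hr
      have h2 := abs_le.1 (hM r hr)
      have h3 : -(l * M) ≤ l * (m * (r - s) - ∫ v in s..r, g v i) := by
        have := mul_le_mul_of_nonneg_left h2.1 hl0.le
        linarith
      linarith
    have hz : Function.update (z t) i (z t i + ((1 - l - 1) * (∫ v in s..t, g v i) +
        l * m * (t - s))) = z t := by
      rw [hmi]
      convert Function.update_eq_self i (z t) using 2
      ring
    rw [hz] at hR
    have hE := h.energy_le hsI htI hst.le hR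
    rw [hmi] at hE
    have hle : ∫ v in s..t, g v i ^ 2 ≤ m ^ 2 * (t - s) := by
      have h1 : 0 ≤ l * (2 - l) * (m ^ 2 * (t - s) - ∫ v in s..t, g v i ^ 2) := by nlinarith
      have h2 : 0 < l * (2 - l) := by nlinarith
      have := nonneg_of_mul_nonneg_right h1 h2
      linarith
    intro r hr
    refine integral_affine_of_le_sq hr (hP.int i) (hP.int_sq i) ?_
    rw [hmi]
    nlinarith
  have hint : ∀ s ∈ Icc a b, ∀ t ∈ Icc a b, ∫ v in s..t, g v i =
      (∫ v in a..t, g v i) - ∫ v in a..s, g v i := by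
    intro s hs t ht
    rw [intervalIntegral.integral_interval_sub_left (hPab.int_of_mem ⟨le_rfl, hab.le⟩ ht i)
      (hPab.int_of_mem ⟨le_rfl, hab.le⟩ hs i)]
  have hcG : ContinuousOn (fun r => ∫ v in a..r, g v i) (Icc a b) := by
    have := intervalIntegral.continuousOn_primitive_interval (μ := volume)
      (f := fun r => g r i) (a := a) (b := b) (by
        rw [uIcc_of_le hab.le]
        exact (intervalIntegrable_iff_integrableOn_Icc_of_le hab.le).1 (hPab.int i))
    rwa [uIcc_of_le hab.le] at this
  have hfin := affine_on_closure hab hcG fun s t hs hst ht r hr => by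
    have := key s t hs hst ht r hr
    rw [hint s ⟨hs.le, (hst.trans ht).le⟩ r ⟨hs.le.trans hr.1, hr.2.trans ht.le⟩,
      hint s ⟨hs.le, (hst.trans ht).le⟩ t ⟨(hs.trans hst).le, ht.le⟩] at this
    exact this
  simp only [intervalIntegral.integral_same, sub_zero] at hfin
  refine ⟨(∫ v in a..b, g v i) / (b - a), fun s hs t ht => ?_⟩
  rw [hint s hs t ht]
  have h1 := hfin s hs
  have h2 := hfin t ht
  field_simp
  linarith

/-- Entries of `R` are nonnegative and `y` is nondecreasing, so regulation can only raise `z i`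
above the line of slope `θ i + m`. -/
theorem IsPiece.le_of_slope (h : IsPiece θ R a b g y z)
    (hR0 : ∀ i j, 0 ≤ R i j) (i : Fin d) {m : ℝ}
    (hm : ∀ s ∈ Icc a b, ∀ t ∈ Icc a b, ∫ v in s..t, g v i = m * (t - s))
    (hs : s ∈ Icc a b) (ht : t ∈ Icc a b) (hst : s ≤ t) :
    z s i + (θ i + m) * (t - s) ≤ z t i := by
  rw [h.increment hs ht i, hm s hs t ht]
  have : 0 ≤ ∑ j, R i j * (y t j - y s j) := Finset.sum_nonneg fun j _ =>
    mul_nonneg (hR0 i j) (sub_nonneg.2 (h.mono j hs ht hst))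
  linarith

/-- A component of `{z i > 0}` that starts while no other coordinate is regulated never ends. -/
theorem IsOpt.pos_of_start (h : IsOpt θ R T g y z)
    (hR0 : ∀ i j, 0 ≤ R i j) (ha : 0 ≤ a) (hab : a < b) (hb : b ≤ T) {i : Fin d}
    (hai : z a i = 0) (hpos : ∀ r ∈ Ioc a b, 0 < z r i) {δ : ℝ} (hδ : δ ∈ Ioc a b)
    (hy : ∀ j, j ≠ i → y δ j = y a j) :
    (∀ r ∈ Ioc a T, 0 < z r i) ∧
    ∃ m : ℝ, (∀ s ∈ Icc a T, ∀ t ∈ Icc a T, ∫ v in s..t, g v i = m * (t - s)) ∧ 0 < θ i + m := by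
  have key : ∀ c, a < c → c ≤ T → δ ≤ c → (∀ r ∈ Ioo a c, 0 < z r i) →
      0 < z c i ∧
      ∃ m : ℝ, (∀ s ∈ Icc a c, ∀ t ∈ Icc a c, ∫ v in s..t, g v i = m * (t - s)) ∧
        0 < θ i + m := by
    intro c hac hcT hδc hp
    obtain ⟨m, hm⟩ := h.exists_slope ha hac hcT hp
    have hP := h.piece.restrict (s := a) (t := c) ⟨ha, hac.le.trans hcT⟩
      ⟨ha.trans hac.le, hcT⟩ hac.le
    have haI : a ∈ Icc a c := ⟨le_rfl, hac.le⟩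
    have hδI : δ ∈ Icc a c := ⟨hδ.1.le, hδc⟩
    have h1 := hP.increment haI hδI i
    -- No regulator acts on `[a, δ]`, so `z δ i = (θ i + m) * (δ - a)`, and its positivity gives the
    -- sign of the drift. The momentum stays the same up to `c`, so this sign persists.
    have h2 : ∑ j, R i j * (y δ j - y a j) = 0 := Finset.sum_eq_zero fun j _ => by
      by_cases hj : j = i
      · subst hj
        rw [hP.y_eq_of_pos hac hp hδI haI]
        ring
      · rw [hy j hj]; ring
    rw [h2, hm a haI δ hδI, hai] at h1
    have h3 := hpos δ hδ
    have h4 : 0 < θ i + m := by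
      have : 0 < (θ i + m) * (δ - a) := by linarith
      exact pos_of_mul_pos_left this (sub_nonneg.2 hδ.1.le)
    refine ⟨?_, m, hm, h4⟩
    have h5 := hP.le_of_slope hR0 i hm haI (show c ∈ Icc a c from ⟨hac.le, le_rfl⟩) hac.le
    have : 0 < (θ i + m) * (c - a) := mul_pos h4 (sub_pos.2 hac)
    linarith
  have hp : ∀ r ∈ Ioc a T, 0 < z r i := by
    intro r hr
    by_contra hcon
    have hz0 : z r i = 0 := le_antisymm (not_lt.1 hcon) (h.piece.nonneg r ⟨ha.trans hr.1.le, hr.2⟩ i)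
    have hbr : b ≤ r := by
      by_contra hlt
      exact hcon (hpos r ⟨hr.1, (not_le.1 hlt).le⟩)
    have hsub : Icc b r ⊆ Icc 0 T := Icc_subset_Icc (ha.trans hab.le) hr.2
    obtain ⟨c, hc, hc0, hcp⟩ := exists_first_zero hbr ((h.piece.continuousOn i).mono hsub)
      (fun u hu => h.piece.nonneg u (hsub hu) i) (hpos b ⟨hab, le_rfl⟩) hz0
    have := (key c (hab.trans hc.1) (hc.2.trans hr.2) (hδ.2.trans hc.1.le) fun u hu => ?_).1
    · rw [hc0] at this; exact lt_irrefl _ this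
    · rcases le_total u b with hub | hub
      · exact hpos u ⟨hu.1, hub⟩
      · exact hcp u ⟨hub, hu.2⟩
  exact ⟨hp, (key T (hab.trans_le hb) le_rfl (hδ.2.trans hb) fun r hr => hp r ⟨hr.1, hr.2.le⟩).2⟩

/-- Near a time at which `z j` is positive, `y j` is constant. -/
theorem IsPiece.exists_y_eq (h : IsPiece θ R a b g y z) {S : Finset (Fin d)} (hab : a < b)
    (hpos : ∀ j ∈ S, 0 < z a j) : ∃ δ ∈ Ioc a b, ∀ j ∈ S, y δ j = y a j := by
  have h1 : ∀ᶠ t in 𝓝[>] a, ∀ j ∈ S, 0 < z t j := by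
    rw [Filter.eventually_all_finset]
    intro j hj
    have : ContinuousWithinAt (fun t => z t j) (Ioi a) a := by
      have := (h.continuousOn j a ⟨le_rfl, hab.le⟩)
      exact (this.mono_of_mem_nhdsWithin (Icc_mem_nhdsGE hab)).mono Ioi_subset_Ici_self
    exact this.eventually (lt_mem_nhds (hpos j hj))
  obtain ⟨u, hu, hsub⟩ := (mem_nhdsGT_iff_exists_Ioc_subset).1 h1
  refine ⟨min u b, ⟨lt_min hu hab, min_le_right _ _⟩, fun j hj => ?_⟩
  have hle : a ≤ min u b := (lt_min hu hab).le
  refine h.compl j a ⟨le_rfl, hab.le⟩ _ ⟨hle, min_le_right _ _⟩ hle fun r hr => ?_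
  rcases hr.1.eq_or_lt with rfl | hlt
  · exact hpos j hj
  · exact hsub ⟨hlt, hr.2.trans (min_le_left _ _)⟩ j hj

theorem IsOpt.isLinearOn (h : IsOpt θ R T g y z)
    (hR : ∀ e : Fin d → ℝ, (∑ i, e i * ∑ j, R i j * e j) = 0 → e = 0)
    (ha : 0 ≤ a) (hab : a < b) (hb : b ≤ T)
    (hK : ∀ i, (∀ r ∈ Ioo a b, 0 < z r i) ∨ ∀ r ∈ Ioo a b, z r i = 0) :
    IsLinearOn z a b := by
  have haI : a ∈ Icc 0 T := ⟨ha, hab.le.trans hb⟩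
  have hbI : b ∈ Icc 0 T := ⟨ha.trans hab.le, hb⟩
  have hP := h.piece.restrict haI hbI hab.le
  have hK' : ∀ i, y b i = y a i ∨ ∀ r ∈ Icc a b, z r i = 0 := by
    intro i
    rcases hK i with hK | hK
    · exact .inl (hP.y_eq_of_pos hab hK ⟨hab.le, le_rfl⟩ ⟨le_rfl, hab.le⟩)
    · refine .inr fun r hr => ?_
      have : EqOn (fun r => z r i) (fun _ => 0) (Icc a b) :=
        EqOn.of_subset_closure (s := Ioo a b) (fun s hs => hK s hs) (hP.continuousOn i)
          continuousOn_const Ioo_subset_Icc_self (by rw [closure_Ioo hab.ne])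
      exact this hr
  refine hP.isLinearOn hab hR hK' (h.energy_le haI hbI hab.le ?_)
  have := (hP.straighten hab hK').reach
  have hba : b - a ≠ 0 := (sub_pos.2 hab).ne'
  simpa [hba] using this

/-- The momentum on a component of `{z i > 0}` which contains a visit to the `i`-th axis. -/
theorem IsOpt.slope_eq (h : IsOpt θ R T g y z) {κ : ℝ}
    (hκ : ∀ i b, 0 < b → ∀ c, Reach θ R 0 (Pi.single i b) c → κ * b ≤ c)
    {i : Fin d} {x : ℝ} (hx : 0 < x) (ha : 0 ≤ a) (hab : a < b) (hb : b ≤ T)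
    (hzb : z b = Pi.single i x) (hE : energy g 0 b = κ * x)
    (hpos : ∀ r ∈ Ioo a b, 0 < z r i) {m : ℝ}
    (hm : ∀ s ∈ Icc a b, ∀ t ∈ Icc a b, ∫ v in s..t, g v i = m * (t - s)) : m = κ := by
  set s := (a + b) / 2 with hs
  have has : a < s := by rw [hs]; linarith
  have hsb : s < b := by rw [hs]; linarith
  have hsI : s ∈ Icc 0 T := ⟨ha.trans has.le, hsb.le.trans hb⟩
  have hbI : b ∈ Icc 0 T := ⟨ha.trans hab.le, hb⟩
  have h0I : (0 : ℝ) ∈ Icc 0 T := ⟨le_rfl, h.piece.le⟩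
  have hP := h.piece.restrict hsI hbI hsb.le
  have hzbi : z b i = x := by simp [hzb]
  have hp : ∀ r ∈ Icc s b, 0 < z r i := fun r hr => by
    rcases hr.2.eq_or_lt with rfl | hlt
    · rw [hzbi]; exact hx
    · exact hpos r ⟨has.trans_le hr.1, hlt⟩
  obtain ⟨r₀, hr₀, hmin⟩ := isCompact_Icc.exists_isMinOn (nonempty_Icc.2 hsb.le)
    (hP.continuousOn i)
  have hδ := hp r₀ hr₀
  set δ := z r₀ i with hδd
  have hD : 0 < b - s := sub_pos.2 hsb
  -- Adding `ε` to the momentum on `[s, b]` moves the endpoint along the axis by `ε * (b - s)`. The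
  -- lower bound `κ * (x + ε * (b - s))` on the new cost holds for both signs of `ε`, which
  -- determines the first-order coefficient `m`.
  have h1 : ∀ ε : ℝ, |ε| * (b - s) < δ → κ * ε ≤ m * ε + ε ^ 2 / 2 := by
    intro ε hε
    have hR := hP.reach_perturb hp 1 ε fun r hr => by
      have h1 : δ ≤ z r i := hmin hr
      have h2 : -(|ε| * (b - s)) ≤ ε * (r - s) := by
        have h3 := neg_abs_le ε
        have h4 : 0 ≤ r - s := sub_nonneg.2 hr.1
        have h5 : r - s ≤ b - s := by linarith [hr.2]
        nlinarith [abs_nonneg ε]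
      linarith
    have hpos' : 0 < x + ε * (b - s) := by
      have h1 : δ ≤ z b i := hmin (show b ∈ Icc s b from ⟨hsb.le, le_rfl⟩)
      have h2 := neg_abs_le ε
      nlinarith
    rw [hm s ⟨has.le, hsb.le⟩ b ⟨hab.le, le_rfl⟩] at hR
    have hz : Function.update (z b) i (z b i + ((1 - 1) * (m * (b - s)) + ε * (b - s))) =
        Pi.single i (x + ε * (b - s)) := by
      rw [hzb]
      funext j
      by_cases hj : j = i
      · subst hj; simp
      · simp [hj]
    rw [hz] at hR
    have hR0 := (h.piece.restrict h0I hsI hsI.1).reach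
    rw [h.zero] at hR0
    have := hκ i _ hpos' _ (hR0.trans hR)
    have hadd := energy_add (h.piece.restrict h0I hbI hbI.1) (r := s) ⟨hsI.1, hsb.le⟩
    have h3 : κ * ε * (b - s) ≤ (m * ε + ε ^ 2 / 2) * (b - s) := by
      rw [← add_assoc, ← hadd, hE] at this
      linarith
    exact le_of_mul_le_mul_right h3 hD
  by_contra hne
  set D := b - s with hDd
  set e := κ - m with he
  have he0 : e ≠ 0 := sub_ne_zero.2 (Ne.symm hne)
  -- `ε = l * (κ - m)` violates the inequality once `l < 2`; the second bound on `l` makes `ε`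
  -- admissible.
  set l := min 1 (δ / (2 * (|e| * D))) with hl
  have hea : 0 < |e| := abs_pos.2 he0
  have hl0 : 0 < l := lt_min one_pos (by positivity)
  have hl1 : l ≤ 1 := min_le_left _ _
  have h2 := h1 (l * e) (by
    rw [abs_mul, abs_of_pos hl0, mul_assoc]
    have : l * (|e| * D) ≤ δ / (2 * (|e| * D)) * (|e| * D) :=
      mul_le_mul_of_nonneg_right (min_le_right _ _) (by positivity)
    have h3 : δ / (2 * (|e| * D)) * (|e| * D) = δ / 2 := by field_simp
    linarith)
  have h3 : l * e ^ 2 * (1 - l / 2) ≤ 0 := by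
    have : κ = e + m := by rw [he]; ring
    rw [this] at h2
    nlinarith
  have h4 : 0 < l * e ^ 2 * (1 - l / 2) := by
    have : 0 < e ^ 2 := by positivity
    have : 0 < 1 - l / 2 := by linarith
    positivity
  linarith

end

/-! ### Stability of the origin and the circulant reflection matrix -/

section

variable {d : ℕ} {θ : Fin d → ℝ} {R : Matrix (Fin d) (Fin d) ℝ} {a b s t T : ℝ}
  {g y z : ℝ → Fin d → ℝ}

theorem IsPiece.integral_eq_zero_of_energy (h : IsPiece θ R a b g y z)
    (hE : energy g a b = 0) (i : Fin d) (hs : s ∈ Icc a b) (ht : t ∈ Icc a b) :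
    ∫ r in s..t, g r i = 0 := by
  have key : ∀ t ∈ Icc a b, ∫ r in a..t, g r i = 0 := by
    intro t ht
    have ha : a ∈ Icc a b := ⟨le_rfl, h.le⟩
    have h1 : energy g a t = 0 := by
      have := energy_add h ht
      have h2 := energy_nonneg (g := g) ht.1
      have h3 := energy_nonneg (g := g) ht.2
      linarith
    unfold energy at h1
    have h2 : ∑ i, ∫ r in a..t, g r i ^ 2 = 0 := by linarith
    have h3 := (Finset.sum_eq_zero_iff_of_nonneg fun i _ =>
      intervalIntegral.integral_nonneg ht.1 fun r _ => sq_nonneg (g r i)).1 h2 i (Finset.mem_univ i)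
    have h4 := sq_integral_le ht.1 (h.int_of_mem ha ht i) (h.int_sq_of_mem ha ht i)
    rw [h3, mul_zero] at h4
    exact pow_eq_zero_iff (two_ne_zero) |>.1 (le_antisymm h4 (sq_nonneg _))
  have ha : a ∈ Icc a b := ⟨le_rfl, h.le⟩
  rw [← intervalIntegral.integral_interval_sub_left (h.int_of_mem ha ht i)
    (h.int_of_mem ha hs i), key t ht, key s hs, sub_zero]

/-- After the last zero `c` of `z i` no regulation occurs, and up to `c` the regulator only has to
compensate the drift, since `R i i = 1` and the other pushes help. This makes `y` Lipschitz, hence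
differentiable almost everywhere. -/
theorem IsPiece.y_sub_le (h : IsPiece θ R a b g y z) (hE : energy g a b = 0)
    (hR1 : ∀ i, R i i = 1) (hR0 : ∀ i j, 0 ≤ R i j) (i : Fin d)
    (hs : s ∈ Icc a b) (ht : t ∈ Icc a b) (hst : s ≤ t) :
    y t i - y s i ≤ |θ i| * (t - s) := by
  by_cases hpos : ∀ r ∈ Icc s t, 0 < z r i
  · rw [h.compl i s hs t ht hst hpos, sub_self]
    exact mul_nonneg (abs_nonneg _) (sub_nonneg.2 hst)
  push Not at hpos
  obtain ⟨u, hu, hzu⟩ := hpos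
  have hsub : Icc u t ⊆ Icc a b := Icc_subset_Icc (hs.1.trans hu.1) ht.2
  have hzu : z u i = 0 := le_antisymm hzu (h.nonneg u (hsub ⟨le_rfl, hu.2⟩) i)
  obtain ⟨c, hc, hzc, hyc⟩ : ∃ c ∈ Icc s t, z c i = 0 ∧ y c i = y t i := by
    rcases (h.nonneg t ht i).eq_or_lt with hzt | hzt
    · exact ⟨t, ⟨hst, le_rfl⟩, hzt.symm, rfl⟩
    · obtain ⟨c, hc, hc0, hcp⟩ := exists_last_zero hu.2 ((h.continuousOn i).mono hsub)
        (fun r hr => h.nonneg r (hsub hr) i) hzu hzt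
      have hcI : c ∈ Icc a b := hsub ⟨hc.1, hc.2.le⟩
      refine ⟨c, ⟨hu.1.trans hc.1, hc.2.le⟩, hc0, ?_⟩
      exact (h.restrict hcI ht hc.2.le).y_eq_of_pos hc.2 (fun r hr => hcp r ⟨hr.1, hr.2.le⟩)
        ⟨le_rfl, hc.2.le⟩ ⟨hc.2.le, le_rfl⟩
  have hcI : c ∈ Icc a b := ⟨hs.1.trans hc.1, hc.2.trans ht.2⟩
  have h1 := h.increment hs hcI i
  rw [h.integral_eq_zero_of_energy hE i hs hcI, hzc] at h1
  have h2 : y c i - y s i ≤ ∑ j, R i j * (y c j - y s j) := by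
    have := Finset.single_le_sum (f := fun j => R i j * (y c j - y s j))
      (fun j _ => mul_nonneg (hR0 i j) (sub_nonneg.2 (h.mono j hs hcI hc.1))) (Finset.mem_univ i)
    simpa [hR1] using this
  have h3 := h.nonneg s hs i
  rw [← hyc]
  have h4 := neg_abs_le (θ i)
  have h5 : 0 ≤ c - s := sub_nonneg.2 hc.1
  have h6 : c - s ≤ t - s := by linarith [hc.2]
  nlinarith [abs_nonneg (θ i)]

/-- Stability: a path of cost zero does not leave the origin. -/
theorem IsPiece.eq_zero_of_energy (h : IsPiece θ R a b g y z) (hE : energy g a b = 0)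
    (hR1 : ∀ i, R i i = 1) (hR0 : ∀ i j, 0 ≤ R i j)
    (hstab : ∀ u : Fin d → ℝ, (∀ i, 0 ≤ u i) → (∀ i, u i * (θ i + ∑ j, R i j * u j) = 0) →
      ∑ i, (θ i + ∑ j, R i j * u j) ≤ 0)
    (hz : z a = 0) : z b = 0 := by
  have hab := h.le
  have ha : a ∈ Icc a b := ⟨le_rfl, hab⟩
  have hb : b ∈ Icc a b := ⟨hab, le_rfl⟩
  have hac : ∀ i, AbsolutelyContinuousOnInterval (fun t => y t i) a b := by
    intro i
    refine LipschitzOnWith.absolutelyContinuousOnInterval (K := ⟨|θ i|, abs_nonneg _⟩) ?_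
    rw [uIcc_of_le hab]
    refine LipschitzOnWith.of_le_add_mul _ fun s hs t ht => ?_
    change y s i ≤ y t i + |θ i| * dist s t
    rcases le_total s t with hst | hst
    · have := h.mono i hs ht hst
      simp only at this
      have h2 : 0 ≤ |θ i| * dist s t := by positivity
      linarith
    · have := h.y_sub_le hE hR1 hR0 i ht hs hst
      rw [Real.dist_eq, abs_of_nonneg (sub_nonneg.2 hst)]
      linarith
  set S : ℝ → ℝ := fun t => ∑ i, ((t - a) * θ i + ∑ j, R i j * (y t j - y a j)) with hS
  have hzS : ∀ t ∈ Icc a b, ∀ i, z t i = (t - a) * θ i + ∑ j, R i j * (y t j - y a j) := by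
    intro t ht i
    rw [h.eq t ht i, h.integral_eq_zero_of_energy hE i ha ht, hz]
    simp
  have hSder : ∀ t, (∀ j, DifferentiableAt ℝ (fun t => y t j) t) → ∀ i,
      HasDerivAt (fun t => (t - a) * θ i + ∑ j, R i j * (y t j - y a j))
        (θ i + ∑ j, R i j * deriv (fun t => y t j) t) t := by
    intro t ht i
    have h1 : HasDerivAt (fun t => (t - a) * θ i) (θ i) t := by
      simpa using ((hasDerivAt_id t).sub_const a).mul_const (θ i)
    refine h1.add ?_
    have := HasDerivAt.fun_sum (u := Finset.univ) (A := fun j t => R i j * (y t j - y a j))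
      (A' := fun j => R i j * deriv (fun t => y t j) t) (x := t) fun j _ =>
        (((ht j).hasDerivAt.sub_const (y a j)).const_mul (R i j))
    exact this
  have hderiv : ∀ᵐ t, t ∈ Ioo a b → deriv S t ≤ 0 := by
    have : ∀ᵐ t, ∀ j, t ∈ uIcc a b → DifferentiableAt ℝ (fun t => y t j) t :=
      ae_all_iff.2 fun j => (hac j).ae_differentiableAt
    filter_upwards [this] with t ht htI
    have htI' : t ∈ Icc a b := Ioo_subset_Icc_self htI
    have hd := fun j => ht j (by rwa [uIcc_of_le hab])
    have hnhds : Icc a b ∈ 𝓝 t := Icc_mem_nhds htI.1 htI.2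
    rw [(HasDerivAt.fun_sum (u := Finset.univ) fun i _ => hSder t hd i).deriv]
    -- Almost everywhere the derivative of `y` is a complementary velocity: where `z i = 0` this is
    -- a minimum, so the velocity of `z i` vanishes; where `z i > 0`, `y i` is locally constant. So
    -- the sum of the coordinates of `z` cannot grow.
    refine hstab _ (fun i => ?_) fun i => ?_
    · have h1 := (hd i).hasDerivAt.hasDerivWithinAt (s := Icc a b)
      have h2 : UniqueDiffWithinAt ℝ (Icc a b) t := uniqueDiffWithinAt_of_mem_nhds hnhds
      rw [← h1.derivWithin h2]
      exact (h.mono i).derivWithin_nonneg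
    · rcases (h.nonneg t htI' i).eq_or_lt with h0 | hp
      · have hz' : HasDerivAt (fun t => z t i)
            (θ i + ∑ j, R i j * deriv (fun t => y t j) t) t :=
          (hSder t hd i).congr_of_eventuallyEq
            (Filter.mem_of_superset hnhds fun r hr => hzS r hr i)
        have hmin : IsLocalMin (fun t => z t i) t :=
          Filter.mem_of_superset hnhds fun r hr => by
            change z t i ≤ z r i
            rw [← h0]; exact h.nonneg r hr i
        rw [hmin.hasDerivAt_eq_zero hz', mul_zero]
      · have hc : ContinuousAt (fun t => z t i) t := (h.continuousOn i).continuousAt hnhds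
        have hev : ∀ᶠ r in 𝓝 t, 0 < z r i := hc.eventually (lt_mem_nhds hp)
        obtain ⟨ε, hε, hball⟩ := Metric.eventually_nhds_iff_ball.1
          (hev.and hnhds)
        have hconst : (fun r => y r i) =ᶠ[𝓝 t] fun _ => y t i := by
          filter_upwards [Metric.ball_mem_nhds t hε] with r hr
          rw [Real.ball_eq_Ioo] at hr hball
          rcases le_total r t with hrt | hrt
          · exact (h.compl i r (hball r hr).2 t htI' hrt fun u hu =>
              (hball u ⟨hr.1.trans_le hu.1, by linarith [hu.2]⟩).1).symm
          · exact h.compl i t htI' r (hball r hr).2 hrt fun u hu =>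
              (hball u ⟨by linarith [hu.1], hu.2.trans_lt hr.2⟩).1
        rw [hconst.deriv_eq]
        simp
  have hSac : AbsolutelyContinuousOnInterval S a b := by
    have h1 : ∀ c : ℝ, AbsolutelyContinuousOnInterval (fun t : ℝ => (t - a) * c) a b := fun c =>
      ContDiffOn.absolutelyContinuousOnInterval (by fun_prop)
    have h2 : ∀ (i : Fin d), AbsolutelyContinuousOnInterval
        (fun t => (t - a) * θ i + ∑ j, R i j * (y t j - y a j)) a b := by
      intro i
      refine AbsolutelyContinuousOnInterval.fun_add (h1 _) ?_
      have : ∀ J : Finset (Fin d), AbsolutelyContinuousOnInterval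
          (fun t => ∑ j ∈ J, R i j * (y t j - y a j)) a b := by
        intro J
        induction J using Finset.induction_on with
        | empty => simpa using h1 0
        | insert j J hj ih =>
          simp only [Finset.sum_insert hj]
          refine AbsolutelyContinuousOnInterval.fun_add ?_ ih
          refine AbsolutelyContinuousOnInterval.const_mul (R i j) ?_
          have hc : AbsolutelyContinuousOnInterval (fun _ : ℝ => y a j) a b :=
            ContDiffOn.absolutelyContinuousOnInterval (by fun_prop)
          exact (hac j).fun_sub hc
      exact this _
    have : ∀ J : Finset (Fin d), AbsolutelyContinuousOnInterval
        (fun t => ∑ i ∈ J, ((t - a) * θ i + ∑ j, R i j * (y t j - y a j))) a b := by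
      intro J
      induction J using Finset.induction_on with
      | empty => simpa using h1 0
      | insert j J hj ih =>
        simp only [Finset.sum_insert hj]
        exact AbsolutelyContinuousOnInterval.fun_add (h2 j) ih
    exact this _
  have h1 := hSac.integral_deriv_eq_sub
  have h2 : ∫ t in a..b, deriv S t ≤ 0 := by
    have h3 : 0 ≤ ∫ t in a..b, -deriv S t := by
      refine intervalIntegral.integral_nonneg_of_ae_restrict hab ?_
      rw [← restrict_Ioo_eq_restrict_Icc]
      refine (ae_restrict_iff' measurableSet_Ioo).2 ?_
      filter_upwards [hderiv] with t ht htI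
      simpa using ht htI
    rw [intervalIntegral.integral_neg] at h3
    linarith
  have h4 : S a = 0 := by simp [hS]
  have h5 : ∑ i, z b i ≤ 0 := by
    have : ∑ i, z b i = S b := Finset.sum_congr rfl fun i _ => hzS b hb i
    linarith
  funext i
  refine le_antisymm ?_ (h.nonneg b hb i)
  exact (Finset.single_le_sum (f := fun i => z b i) (fun i _ => h.nonneg b hb i)
    (Finset.mem_univ i)).trans h5

/-- The reflection matrix of rotationally symmetric data. -/
def circ (r₁ r₂ : ℝ) : Matrix (Fin 3) (Fin 3) ℝ := !![1, r₂, r₁; r₁, 1, r₂; r₂, r₁, 1]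

theorem circ_add (r₁ r₂ : ℝ) (m i j : Fin 3) : circ r₁ r₂ (i + m) (j + m) = circ r₁ r₂ i j := by
  fin_cases m <;> fin_cases i <;> fin_cases j <;> rfl

theorem circ_self (r₁ r₂ : ℝ) (i : Fin 3) : circ r₁ r₂ i i = 1 := by
  fin_cases i <;> rfl

theorem circ_nonneg {r₁ r₂ : ℝ} (h₁ : 0 ≤ r₁) (h₂ : 0 ≤ r₂) (i j : Fin 3) :
    0 ≤ circ r₁ r₂ i j := by
  fin_cases i <;> fin_cases j <;> simp [circ, h₁, h₂]

/-- Twice the quadratic form is `(2 - (r₁ + r₂)) * |e|² + (r₁ + r₂) * (e 0 + e 1 + e 2)²`. -/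
theorem circ_posDef {r₁ r₂ : ℝ} (h₁ : 0 ≤ r₁ + r₂) (h : r₁ + r₂ < 2) (e : Fin 3 → ℝ)
    (he : ∑ i, e i * ∑ j, circ r₁ r₂ i j * e j = 0) : e = 0 := by
  simp only [Fin.sum_univ_three, circ, Matrix.of_apply, Matrix.cons_val', Matrix.cons_val_zero,
    Matrix.cons_val_one, Matrix.cons_val, Matrix.cons_val_fin_one] at he
  have h2 : (2 - (r₁ + r₂)) * (e 0 ^ 2 + e 1 ^ 2 + e 2 ^ 2) +
      (r₁ + r₂) * (e 0 + e 1 + e 2) ^ 2 = 0 := by linarith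
  have h3 : 0 ≤ (r₁ + r₂) * (e 0 + e 1 + e 2) ^ 2 := by positivity
  have h4 : e 0 ^ 2 + e 1 ^ 2 + e 2 ^ 2 ≤ 0 := by
    by_contra hcon
    have := mul_pos (sub_pos.2 h) (not_le.1 hcon)
    linarith
  funext i
  have h5 : e i ^ 2 ≤ 0 := by
    fin_cases i <;> simp <;> nlinarith [sq_nonneg (e 0), sq_nonneg (e 1), sq_nonneg (e 2)]
  exact pow_eq_zero_iff two_ne_zero |>.1 (le_antisymm h5 (sq_nonneg _))

/-- With `U = ∑ u i`, the sum in question is `3 θ₀ + (1 + r₁ + r₂) U`. Adding the complementarity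
relations and using `u ⬝ R u ≥ (1 + r₁ + r₂) U² / 3` shows that `U` times this sum is nonpositive;
if `U = 0`, the sign of `θ₀` decides. -/
theorem circ_stable {r₁ r₂ θ₀ : ℝ} (hθ : θ₀ < 0) (h : r₁ + r₂ < 2)
    (u : Fin 3 → ℝ) (hu : ∀ i, 0 ≤ u i)
    (hc : ∀ i, u i * (θ₀ + ∑ j, circ r₁ r₂ i j * u j) = 0) :
    ∑ i, (θ₀ + ∑ j, circ r₁ r₂ i j * u j) ≤ 0 := by
  have c0 := hc 0
  have c1 := hc 1
  have c2 := hc 2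
  have u0 := hu 0
  have u1 := hu 1
  have u2 := hu 2
  simp only [Fin.sum_univ_three, circ, Matrix.of_apply, Matrix.cons_val', Matrix.cons_val_zero,
    Matrix.cons_val_one, Matrix.cons_val, Matrix.cons_val_fin_one] at *
  set U := u 0 + u 1 + u 2 with hU
  have e1 : U * (3 * θ₀ + (1 + (r₁ + r₂)) * U) ≤ 0 := by
    have h3 : 0 ≤ (2 - (r₁ + r₂)) *
        ((u 0 - u 1) ^ 2 + (u 1 - u 2) ^ 2 + (u 0 - u 2) ^ 2) :=
      mul_nonneg (sub_nonneg.2 h.le) (by positivity)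
    rw [hU]
    nlinarith
  have e2 : 3 * θ₀ + (1 + (r₁ + r₂)) * U ≤ 0 := by
    rcases (show 0 ≤ U by positivity).eq_or_lt with h0 | h0
    · rw [← h0]; linarith
    · by_contra hcon
      have := mul_pos h0 (not_le.1 hcon)
      linarith
  rw [hU] at e2
  linarith

end

/-! ### Optimal paths to an axis, and what the absence of a direct step implies -/

section

theorem exists_third (i j : Fin 3) (h : i ≠ j) :
    ∃ k, k ≠ i ∧ k ≠ j ∧ ∀ l, l = i ∨ l = j ∨ l = k := by
  revert i j; decide

theorem eq_single_of_third {p : Fin 3 → ℝ} {i j k : Fin 3}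
    (hl : ∀ l, l = i ∨ l = j ∨ l = k) (hi : p i = 0) (hj : p j = 0) :
    p = Pi.single k (p k) := by
  funext l
  by_cases hk : l = k
  · subst hk; simp
  · rcases hl l with rfl | rfl | rfl
    · simp [hk, hi]
    · simp [hk, hj]
    · exact absurd rfl hk

/-- Rotating axis `i` to axis `j` is free, and rescaling multiplies cost and distance by the same
factor. -/
theorem Reach.axis {θ₀ r₁ r₂ : ℝ} {i : Fin 3} {b c : ℝ}
    (h : Reach (fun _ => θ₀) (circ r₁ r₂) 0 (Pi.single i b) c) (hb : 0 < b) (j : Fin 3) {b' : ℝ}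
    (hb' : 0 < b') :
    Reach (fun _ => θ₀) (circ r₁ r₂) 0 (Pi.single j b') (b' / b * c) := by
  have h1 := (h.rotate (circ_add r₁ r₂) (i - j)).smul (div_pos hb' hb)
  convert h1 using 1
  · funext l; simp
  · funext l
    by_cases hl : l = j
    · subst hl; simp; field_simp
    · have : l + (i - j) ≠ i := fun h => hl (by
        have := congrArg (· - (i - j)) h
        simpa using this)
      simp [hl, this]

/-- An optimal path to the point at distance `x₀` from the origin on the `i₀`-th axis; `κ` is the
cost of reaching a point on an axis at distance one. -/
structure IsAxisOpt (θ₀ r₁ r₂ T : ℝ) (g y z : ℝ → Fin 3 → ℝ) (i₀ : Fin 3) (x₀ κ : ℝ) : Prop where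
  opt : IsOpt (fun _ => θ₀) (circ r₁ r₂) T g y z
  r₁_nonneg : 0 ≤ r₁
  r₂_nonneg : 0 ≤ r₂
  sum_lt : r₁ + r₂ < 2
  neg : θ₀ < 0
  end_eq : z T = Pi.single i₀ x₀
  x₀_pos : 0 < x₀
  energy_eq : energy g 0 T = κ * x₀

variable {θ₀ r₁ r₂ T : ℝ} {g y z : ℝ → Fin 3 → ℝ} {i₀ : Fin 3} {x₀ κ : ℝ}

namespace IsAxisOpt

theorem eq_zero_of_energy (h : IsAxisOpt θ₀ r₁ r₂ T g y z i₀ x₀ κ) {t : ℝ} (ht : t ∈ Icc 0 T)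
    (hE : energy g 0 t = 0) : z t = 0 :=
  (h.opt.piece.restrict ⟨le_rfl, h.opt.piece.le⟩ ht ht.1).eq_zero_of_energy hE (circ_self r₁ r₂)
    (circ_nonneg h.r₁_nonneg h.r₂_nonneg) (circ_stable h.neg h.sum_lt) h.opt.zero

/-- A path of zero cost would stay at the origin, but `x₀ > 0`. -/
theorem κ_pos (h : IsAxisOpt θ₀ r₁ r₂ T g y z i₀ x₀ κ) : 0 < κ := by
  have h1 := energy_nonneg (g := g) h.opt.piece.le
  rw [h.energy_eq] at h1
  refine (nonneg_of_mul_nonneg_left h1 h.x₀_pos).lt_of_ne fun h0 => ?_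
  have h2 := h.eq_zero_of_energy ⟨h.opt.piece.le, le_rfl⟩ (by rw [h.energy_eq, ← h0, zero_mul])
  have h3 := congrFun h2 i₀
  rw [h.end_eq] at h3
  simp only [Pi.single_eq_same, Pi.zero_apply] at h3
  exact h.x₀_pos.ne' h3

theorem le_of_reach (h : IsAxisOpt θ₀ r₁ r₂ T g y z i₀ x₀ κ) (i : Fin 3) (b : ℝ) (hb : 0 < b)
    (c : ℝ) (hc : Reach (fun _ => θ₀) (circ r₁ r₂) 0 (Pi.single i b) c) : κ * b ≤ c := by
  have h1 := hc.axis hb i₀ h.x₀_pos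
  rw [← h.end_eq] at h1
  have h2 := h.opt.opt _ h1
  rw [h.energy_eq] at h2
  have h3 : x₀ * (κ * b) ≤ x₀ * c := by
    have := mul_le_mul_of_nonneg_right h2 hb.le
    have h4 : x₀ / b * c * b = x₀ * c := by field_simp
    linarith
  exact le_of_mul_le_mul_left h3 h.x₀_pos

/-- The upper bound compares the initial part with a rotated and rescaled copy of the whole optimal
path; the lower bound is `le_of_reach`. -/
theorem energy_of_axis (h : IsAxisOpt θ₀ r₁ r₂ T g y z i₀ x₀ κ) {t : ℝ} (ht : t ∈ Icc 0 T)
    {i : Fin 3} {x : ℝ} (hx : 0 < x) (hz : z t = Pi.single i x) : energy g 0 t = κ * x := by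
  have h0 : (0 : ℝ) ∈ Icc 0 T := ⟨le_rfl, h.opt.piece.le⟩
  refine le_antisymm ?_ ?_
  · have h1 := h.opt.piece.reach
    rw [h.opt.zero, h.end_eq, h.energy_eq] at h1
    have h2 := h1.axis h.x₀_pos i hx
    rw [← hz, ← h.opt.zero] at h2
    have h3 := h.opt.energy_le h0 ht ht.1 h2
    have h4 : x / x₀ * (κ * x₀) = κ * x := by
      have := h.x₀_pos.ne'
      field_simp
    linarith
  · have h1 := (h.opt.piece.restrict h0 ht ht.1).reach
    rw [h.opt.zero, hz] at h1
    exact h.le_of_reach i x hx _ h1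

theorem slope_eq (h : IsAxisOpt θ₀ r₁ r₂ T g y z i₀ x₀ κ) {i : Fin 3} {x a b : ℝ} (hx : 0 < x)
    (ha : 0 ≤ a) (hab : a < b) (hb : b ≤ T) (hzb : z b = Pi.single i x)
    (hpos : ∀ r ∈ Ioo a b, 0 < z r i) {m : ℝ}
    (hm : ∀ s ∈ Icc a b, ∀ t ∈ Icc a b, ∫ v in s..t, g v i = m * (t - s)) : m = κ :=
  h.opt.slope_eq h.le_of_reach hx ha hab hb hzb
    (h.energy_of_axis ⟨ha.trans hab.le, hb⟩ hx hzb) hpos hm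

theorem eq_of_end_pos (h : IsAxisOpt θ₀ r₁ r₂ T g y z i₀ x₀ κ) {i : Fin 3} (hi : 0 < z T i) :
    i = i₀ := by
  by_contra hne
  rw [h.end_eq] at hi
  simp [hne] at hi

/-- Up to a return to the origin an optimal path spends nothing, since remaining there for zero time
is free; by stability it has then not moved at all. -/
theorem exists_last_origin (h : IsAxisOpt θ₀ r₁ r₂ T g y z i₀ x₀ κ) :
    ∃ t₀ ∈ Ico 0 T, (∀ t ∈ Icc 0 t₀, z t = 0) ∧ ∀ t ∈ Ioc t₀ T, z t ≠ 0 := by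
  have hP := h.opt.piece
  have hT : T ∈ Icc 0 T := ⟨hP.le, le_rfl⟩
  have h0 : (0 : ℝ) ∈ Icc 0 T := ⟨le_rfl, hP.le⟩
  obtain ⟨t₀, ht₀, hz₀, hpos⟩ := exists_last_zero (f := fun t => ∑ i, z t i) hP.le
    (continuousOn_finsetSum _ fun i _ => hP.continuousOn i)
    (fun t ht => Finset.sum_nonneg fun i _ => hP.nonneg t ht i)
    (by simp [h.opt.zero]) (by simp [h.end_eq, h.x₀_pos])
  have ht₀I : t₀ ∈ Icc 0 T := ⟨ht₀.1, ht₀.2.le⟩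
  have hzt : z t₀ = 0 := by
    funext i
    exact (Finset.sum_eq_zero_iff_of_nonneg fun i _ => hP.nonneg t₀ ht₀I i).1 hz₀ i
      (Finset.mem_univ i)
  refine ⟨t₀, ht₀, fun t ht => ?_, fun t ht hz => ?_⟩
  · refine h.eq_zero_of_energy ⟨ht.1, ht.2.trans ht₀.2.le⟩ ?_
    have h1 : energy g 0 t₀ ≤ 0 := by
      refine h.opt.energy_le h0 ht₀I ht₀.1 ?_
      rw [h.opt.zero, hzt]
      exact Reach.refl le_rfl
    have h2 := energy_add (hP.restrict h0 ht₀I ht₀.1) ht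
    have h3 := energy_nonneg (g := g) ht.1
    have h4 := energy_nonneg (g := g) ht.2
    linarith
  · have := hpos t ht
    simp [hz] at this

end IsAxisOpt

/-- A straight step along a face, from one axis to a farther point of another axis, of relative
cost at most `κ`. -/
def HasDirectStep (θ₀ r₁ r₂ κ : ℝ) : Prop :=
  ∃ (i j k : Fin 3) (a b D u : ℝ) (γ : Fin 3 → ℝ), j ≠ i ∧ k ≠ i ∧ k ≠ j ∧ 0 < a ∧ a < b ∧
    0 < D ∧ 0 ≤ u ∧
    (∀ l, (Pi.single i b : Fin 3 → ℝ) l - (Pi.single j a : Fin 3 → ℝ) l =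
      D * (θ₀ + γ l + circ r₁ r₂ l k * u)) ∧
    1 / 2 * D * ∑ l, γ l ^ 2 ≤ κ * (b - a)

namespace IsAxisOpt

/-- The stretch between two axis visits costs exactly `κ * (b - a)`. Only `k` is regulated on it,
and `z k` stays at zero there, so replacing all velocities by their averages gives a straight step
that costs no more. -/
theorem hasDirectStep_of_pieces (h : IsAxisOpt θ₀ r₁ r₂ T g y z i₀ x₀ κ) {s t : ℝ} (hs : 0 ≤ s)
    (hst : s < t) (ht : t ≤ T) {i j k : Fin 3} {a b : ℝ} (hji : j ≠ i) (hki : k ≠ i) (hkj : k ≠ j)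
    (hl : ∀ l, l = i ∨ l = j ∨ l = k)
    (ha : 0 < a) (hb : 0 < b) (hzs : z s = Pi.single j a) (hzt : z t = Pi.single i b)
    (hi : ∀ r ∈ Ioo s t, 0 < z r i) (hj : ∀ r ∈ Ioo s t, 0 < z r j)
    (hk : ∀ r ∈ Icc s t, z r k = 0)
    (hm : ∫ v in s..t, g v i = κ * (t - s)) : HasDirectStep θ₀ r₁ r₂ κ := by
  have hsI : s ∈ Icc 0 T := ⟨hs, hst.le.trans ht⟩
  have htI : t ∈ Icc 0 T := ⟨hs.trans hst.le, ht⟩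
  have hP := h.opt.piece.restrict hsI htI hst.le
  have hss : s ∈ Icc s t := ⟨le_rfl, hst.le⟩
  have htt : t ∈ Icc s t := ⟨hst.le, le_rfl⟩
  have hts : 0 < t - s := sub_pos.2 hst
  have hE : energy g s t = κ * (b - a) := by
    have h1 := energy_add (h.opt.piece.restrict ⟨le_rfl, h.opt.piece.le⟩ htI htI.1)
      (r := s) ⟨hs, hst.le⟩
    rw [h.energy_of_axis htI hb hzt, h.energy_of_axis hsI ha hzs] at h1
    linarith
  -- Equality would mean zero cost, hence zero mean momentum, whereas the mean of `g i` is `κ > 0`.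
  have hab : a < b := by
    have h1 := energy_nonneg (g := g) hst.le
    rw [hE] at h1
    have h2 : 0 ≤ b - a := nonneg_of_mul_nonneg_right h1 h.κ_pos
    refine (sub_nonneg.1 h2).lt_of_ne fun heq => ?_
    have h3 := hP.integral_eq_zero_of_energy (by rw [hE, heq, sub_self, mul_zero]) i hss htt
    rw [hm] at h3
    exact (mul_pos h.κ_pos hts).ne' h3
  have hyi : y t i = y s i := hP.y_eq_of_pos hst hi htt hss
  have hyj : y t j = y s j := hP.y_eq_of_pos hst hj htt hss
  refine ⟨i, j, k, a, b, t - s, (y t k - y s k) / (t - s),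
    fun l => (∫ v in s..t, g v l) / (t - s), hji, hki, hkj, ha, hab, hts,
    div_nonneg (sub_nonneg.2 (hP.mono k hss htt hst.le)) hts.le, fun l => ?_, ?_⟩
  · have h1 := hP.increment hss htt l
    have h2 : ∑ j, circ r₁ r₂ l j * (y t j - y s j) = circ r₁ r₂ l k * (y t k - y s k) := by
      refine Finset.sum_eq_single k (fun l' _ hl' => ?_) (by simp)
      rcases hl l' with rfl | rfl | rfl
      · rw [hyi]; ring
      · rw [hyj]; ring
      · exact absurd rfl hl'
    rw [h2, hzs, hzt] at h1
    rw [h1]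
    field_simp
    ring
  · have h1 := energy_straighten_le hP hst
    rw [energy_const (fun i => ∫ v in s..t, g v i) hst, hE] at h1
    refine le_trans (le_of_eq ?_) h1
    rw [mul_assoc, Finset.mul_sum]
    congr 1
    refine Finset.sum_congr rfl fun l _ => ?_
    field_simp

/-- The component of `{z i > 0}` from `α` to the axis visit at `τ` has momentum `κ` and so downward
drift; it can start only with the help of another regulator. This puts `z α` on an axis `j`, and the
stretch until `z j` first vanishes is the direct step. -/
theorem hasDirectStep (h : IsAxisOpt θ₀ r₁ r₂ T g y z i₀ x₀ κ) (hμ : θ₀ + κ < 0) {α τ : ℝ}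
    (hα : 0 ≤ α) (hατ : α < τ) (hτ : τ ≤ T) (hzα : z α ≠ 0) {i : Fin 3} {x : ℝ} (hx : 0 < x)
    (hzτ : z τ = Pi.single i x) (hαi : z α i = 0) (hpos : ∀ r ∈ Ioc α τ, 0 < z r i) :
    HasDirectStep θ₀ r₁ r₂ κ := by
  have hP := h.opt.piece
  have hR0 := circ_nonneg h.r₁_nonneg h.r₂_nonneg
  have hαI : α ∈ Icc 0 T := ⟨hα, hατ.le.trans hτ⟩
  have hαT := hατ.trans_le hτ
  have hPα := hP.restrict hαI ⟨h.opt.piece.le, le_rfl⟩ hαT.le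
  have hpos' : ∀ r ∈ Ioo α τ, 0 < z r i := fun r hr => hpos r ⟨hr.1, hr.2.le⟩
  obtain ⟨m, hm⟩ := h.opt.exists_slope hα hατ hτ hpos'
  obtain rfl := h.slope_eq hx hα hατ hτ hzτ hpos' hm
  -- a component which starts unregulated has positive slope
  have hcontra : ∀ δ ∈ Ioc α τ, ¬ ∀ j, j ≠ i → y δ j = y α j := by
    intro δ hδ hy
    obtain ⟨-, m', hm', hm'0⟩ := h.opt.pos_of_start hR0 hα hατ hτ hαi hpos hδ hy
    have h1 := hm' α ⟨le_rfl, hαT.le⟩ τ ⟨hατ.le, hτ⟩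
    rw [hm α ⟨le_rfl, hατ.le⟩ τ ⟨hατ.le, le_rfl⟩] at h1
    have h2 := mul_right_cancel₀ (sub_pos.2 hατ).ne' h1
    linarith
  obtain ⟨k, hki, hαk⟩ : ∃ k, k ≠ i ∧ z α k = 0 := by
    by_contra! hcon
    have hPτ := hP.restrict hαI ⟨hα.trans hατ.le, hτ⟩ hατ.le
    obtain ⟨δ, hδ, hy⟩ := hPτ.exists_y_eq (S := Finset.univ.erase i) hατ fun j hj =>
      (hP.nonneg α hαI j).lt_of_ne (hcon j (Finset.ne_of_mem_erase hj)).symm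
    exact hcontra δ hδ fun j hj => hy j (Finset.mem_erase.2 ⟨hj, Finset.mem_univ j⟩)
  obtain ⟨j, hji, hjk, hl⟩ := exists_third i k hki.symm
  have hzα' : z α = Pi.single j (z α j) := eq_single_of_third hl hαi hαk
  have hαj : 0 < z α j := (hP.nonneg α hαI j).lt_of_ne fun h0 => hzα (by
    rw [hzα', ← h0]; simp)
  have hτj : z τ j = 0 := by rw [hzτ]; simp [hji]
  have hsub : Icc α τ ⊆ Icc 0 T := Icc_subset_Icc hα hτ
  obtain ⟨t, ht, htj, hposj⟩ := exists_first_zero hατ.le ((hP.continuousOn j).mono hsub)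
    (fun u hu => hP.nonneg u (hsub hu) j) hαj hτj
  have hPt := hP.restrict hαI (hsub ⟨ht.1.le, ht.2⟩) ht.1.le
  have hzk : ∀ r ∈ Ioo α t, z r k = 0 := by
    intro r hr
    by_contra hne
    have hrI : r ∈ Icc 0 T := hsub ⟨hr.1.le, (hr.2.trans_le ht.2).le⟩
    have hrk : 0 < z r k := (hP.nonneg r hrI k).lt_of_ne (Ne.symm hne)
    have hsub' : Icc α r ⊆ Icc 0 T := Icc_subset_Icc hα hrI.2
    obtain ⟨β, hβ, hβk, hposk⟩ := exists_last_zero hr.1.le ((hP.continuousOn k).mono hsub')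
      (fun u hu => hP.nonneg u (hsub' hu) k) hαk hrk
    have hβ0 : 0 ≤ β := hα.trans hβ.1
    have hβI : β ∈ Icc 0 T := ⟨hβ0, hβ.2.le.trans hrI.2⟩
    -- If `z k` leaves zero right at `α`, no coordinate other than `i` is regulated there, against
    -- `hcontra`. If it leaves later, its excursion starts unregulated and lasts until `T`, so `k =
    -- i₀` and its momentum is `κ`, contradicting `θ₀ + κ < 0`.
    rcases hβ.1.eq_or_lt with rfl | hαβ
    · refine hcontra r ⟨hr.1, (hr.2.trans_le ht.2).le⟩ fun l hli => ?_
      rcases hl l with rfl | rfl | rfl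
      · exact absurd rfl hli
      · exact (hP.restrict hαI hrI hr.1.le).y_eq_of_pos hr.1
          (fun u hu => hposk u ⟨hu.1, hu.2.le⟩) ⟨hr.1.le, le_rfl⟩ ⟨le_rfl, hr.1.le⟩
      · exact hPt.y_eq_of_pos ht.1
          (fun u hu => hposj u ⟨hu.1.le, hu.2⟩) ⟨hr.1.le, hr.2.le⟩ ⟨le_rfl, ht.1.le⟩
    · have hβT : β < T := hβ.2.trans_le hrI.2
      have hPβ := hP.restrict hβI hrI hβ.2.le
      obtain ⟨δ, hδ, hy⟩ := hPβ.exists_y_eq (S := Finset.univ.erase k) hβ.2 fun l hl' => by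
        rcases hl l with rfl | rfl | rfl
        · exact hpos β ⟨hαβ, (hβ.2.trans hr.2).le.trans ht.2⟩
        · exact absurd rfl (Finset.ne_of_mem_erase hl')
        · exact hposj β ⟨hαβ.le, hβ.2.trans hr.2⟩
      obtain ⟨hp, m', hm', hm'0⟩ := h.opt.pos_of_start hR0 hβ0 hβ.2 hrI.2 hβk hposk hδ
        fun l hl' => hy l (Finset.mem_erase.2 ⟨hl', Finset.mem_univ l⟩)
      obtain rfl := h.eq_of_end_pos (hp T ⟨hβT, le_rfl⟩)
      have := h.slope_eq h.x₀_pos hβ0 hβT le_rfl h.end_eq (fun u hu => hp u ⟨hu.1, hu.2.le⟩) hm'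
      linarith
  have hzk' : ∀ r ∈ Icc α t, z r k = 0 := by
    intro r hr
    have : EqOn (fun r => z r k) (fun _ => 0) (Icc α t) :=
      EqOn.of_subset_closure (s := Ioo α t) (fun s hs => hzk s hs) (hPt.continuousOn k)
        continuousOn_const Ioo_subset_Icc_self (by rw [closure_Ioo ht.1.ne])
    exact this hr
  have hl' : ∀ l, l = j ∨ l = k ∨ l = i := fun l => by
    rcases hl l with h | h | h <;> simp [h]
  have hzt := eq_single_of_third hl' htj (hzk' t ⟨ht.1.le, le_rfl⟩)
  refine h.hasDirectStep_of_pieces hα ht.1 (ht.2.trans hτ) hji hki hjk.symm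
    (fun l => by rcases hl l with h | h | h <;> simp [h]) hαj (hpos t ⟨ht.1, ht.2⟩) hzα' hzt
    (fun r hr => hpos r ⟨hr.1, hr.2.le.trans ht.2⟩) (fun r hr => hposj r ⟨hr.1.le, hr.2⟩) hzk' ?_
  exact hm α ⟨le_rfl, hατ.le⟩ t ⟨ht.1.le, ht.2⟩

/-- Without a direct step, an axis, once visited, is not left by the corresponding coordinate. -/
theorem pos_after_axis (h : IsAxisOpt θ₀ r₁ r₂ T g y z i₀ x₀ κ)
    (hno : ¬ HasDirectStep θ₀ r₁ r₂ κ) {t₀ : ℝ} (ht₀ : 0 ≤ t₀) (hz₀ : z t₀ = 0)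
    (hne : ∀ t ∈ Ioc t₀ T, z t ≠ 0) {τ : ℝ} (hτ : τ ∈ Ioc t₀ T) {i : Fin 3} {x : ℝ}
    (hzτ : z τ = Pi.single i x) : ∀ r ∈ Icc τ T, 0 < z r i := by
  have hP := h.opt.piece
  have hR0 := circ_nonneg h.r₁_nonneg h.r₂_nonneg
  have key : ∀ τ ∈ Ioc t₀ T, ∀ i, 0 < z τ i →
      ∃ α ∈ Ico t₀ τ, z α i = 0 ∧ ∀ t ∈ Ioc α τ, 0 < z t i := by
    intro τ hτ i hi
    have hsub : Icc t₀ τ ⊆ Icc 0 T := Icc_subset_Icc ht₀ hτ.2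
    exact exists_last_zero hτ.1.le ((hP.continuousOn i).mono hsub)
      (fun u hu => hP.nonneg u (hsub hu) i) (by rw [hz₀]; rfl) hi
  have hτI : τ ∈ Icc 0 T := ⟨ht₀.trans hτ.1.le, hτ.2⟩
  have hx : 0 < x := by
    have h1 := hP.nonneg τ hτI i
    rw [hzτ] at h1
    simp only [Pi.single_eq_same] at h1
    exact h1.lt_of_ne fun h0 => hne τ hτ (by rw [hzτ, ← h0]; simp)
  have hτi : 0 < z τ i := by rw [hzτ]; simpa using hx
  -- With downward drift, the final excursion of coordinate `i₀` must start at the origin, so it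
  -- covers time `τ` and `i = i₀`. Otherwise the momentum `κ` of the excursion through `τ` never
  -- lets `z i` decrease to zero.
  rcases lt_or_ge (θ₀ + κ) 0 with hμ | hμ
  · have hend : 0 < z T i₀ := by rw [h.end_eq]; simpa using h.x₀_pos
    obtain ⟨α, hα, hα0, hp⟩ := key T ⟨hτ.1.trans_le hτ.2, le_rfl⟩ i₀ hend
    rcases hα.1.eq_or_lt with rfl | hlt
    · have hi : i = i₀ := by
        by_contra hcon
        have h1 := hp τ hτ
        rw [hzτ] at h1
        simp [Ne.symm hcon] at h1
      subst hi
      exact fun r hr => hp r ⟨hτ.1.trans_le hr.1, hr.2⟩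
    · exact absurd (h.hasDirectStep hμ (ht₀.trans hα.1) hα.2 le_rfl (hne α ⟨hlt, hα.2.le⟩)
        h.x₀_pos h.end_eq hα0 hp) hno
  · intro r hr
    by_contra hcon
    have hrI : r ∈ Icc 0 T := ⟨hτI.1.trans hr.1, hr.2⟩
    have hr0 : z r i = 0 := le_antisymm (not_lt.1 hcon) (hP.nonneg r hrI i)
    have hsub : Icc τ r ⊆ Icc 0 T := Icc_subset_Icc hτI.1 hr.2
    obtain ⟨β, hβ, hβ0, hpβ⟩ := exists_first_zero hr.1 ((hP.continuousOn i).mono hsub)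
      (fun u hu => hP.nonneg u (hsub hu) i) hτi hr0
    obtain ⟨α, hα, -, hpα⟩ := key τ hτ i hτi
    have hα0 := ht₀.trans hα.1
    have hβT := hβ.2.trans hr.2
    obtain ⟨m, hm⟩ := h.opt.exists_slope (i := i) hα0 (hα.2.trans hβ.1) hβT fun u hu => by
      rcases le_total u τ with hu' | hu'
      · exact hpα u ⟨hu.1, hu'⟩
      · exact hpβ u ⟨hu', hu.2⟩
    obtain rfl := h.slope_eq hx hα0 hα.2 hτ.2 hzτ (fun u hu => hpα u ⟨hu.1, hu.2.le⟩)
      fun s hs t ht => hm s ⟨hs.1, hs.2.trans hβ.1.le⟩ t ⟨ht.1, ht.2.trans hβ.1.le⟩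
    have h1 := (hP.restrict ⟨hα0, (hα.2.trans hβ.1).le.trans hβT⟩
      ⟨hα0.trans (hα.2.trans hβ.1).le, hβT⟩ (hα.2.trans hβ.1).le).le_of_slope hR0 i hm
      (s := τ) (t := β) ⟨hα.2.le, hβ.1.le⟩ ⟨(hα.2.trans hβ.1).le, le_rfl⟩ hβ.1.le
    have h2 := mul_nonneg hμ (sub_nonneg.2 hβ.1.le)
    linarith

/-- Without a direct step, a component of `{z i > 0}` which starts after the last visit to the
origin never ends. -/
theorem pos_after_start (h : IsAxisOpt θ₀ r₁ r₂ T g y z i₀ x₀ κ)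
    (hno : ¬ HasDirectStep θ₀ r₁ r₂ κ) {t₀ : ℝ} (ht₀ : 0 ≤ t₀) (hz₀ : z t₀ = 0)
    (hne : ∀ t ∈ Ioc t₀ T, z t ≠ 0) {α r : ℝ} (hα : t₀ < α) (hαr : α < r) (hr : r ≤ T) {i : Fin 3}
    (hαi : z α i = 0) (hpos : ∀ t ∈ Ioc α r, 0 < z t i) : ∀ t ∈ Ioc α T, 0 < z t i := by
  have hP := h.opt.piece
  have hR0 := circ_nonneg h.r₁_nonneg h.r₂_nonneg
  have hα0 := ht₀.trans hα.le
  have hαT := hαr.trans_le hr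
  have hαI : α ∈ Icc 0 T := ⟨hα0, hαT.le⟩
  have hrI : r ∈ Icc 0 T := ⟨hα0.trans hαr.le, hr⟩
  by_cases hcon : ∃ j, j ≠ i ∧ z α j = 0
  swap
  · push Not at hcon
    obtain ⟨δ, hδ, hy⟩ := (hP.restrict hαI hrI hαr.le).exists_y_eq (S := Finset.univ.erase i) hαr
      fun j hj => (hP.nonneg α hαI j).lt_of_ne (hcon j (Finset.ne_of_mem_erase hj)).symm
    exact (h.opt.pos_of_start hR0 hα0 hαr hr hαi hpos hδ
      fun j hj => hy j (Finset.mem_erase.2 ⟨hj, Finset.mem_univ j⟩)).1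
  obtain ⟨j, hji, hαj⟩ := hcon
  obtain ⟨k, hki, hkj, hl⟩ := exists_third i j hji.symm
  -- Here `α` is a visit to axis `k`, so `k = i₀` stays positive. If the excursion of `i` ended at
  -- `β`, then `z j` would vanish in between, the path would be affine on `[α, β]`, and `z i` could
  -- not be zero at both ends and positive inside.
  have hposk := h.pos_after_axis hno ht₀ hz₀ hne ⟨hα, hαT.le⟩ (eq_single_of_third hl hαi hαj)
  have hk := h.eq_of_end_pos (hposk T ⟨hαT.le, le_rfl⟩)
  by_contra hcon
  have hTi : z T i = 0 := by
    rw [h.end_eq]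
    simp [hk ▸ hki.symm]
  have hsub : Icc r T ⊆ Icc 0 T := Icc_subset_Icc hrI.1 le_rfl
  obtain ⟨β, hβ, hβ0, hpβ⟩ := exists_first_zero hr ((hP.continuousOn i).mono hsub)
    (fun u hu => hP.nonneg u (hsub hu) i) (hpos r ⟨hαr, le_rfl⟩) hTi
  have hαβ := hαr.trans hβ.1
  have hposi : ∀ u ∈ Ioo α β, 0 < z u i := fun u hu => by
    rcases le_total u r with h1 | h1
    · exact hpos u ⟨hu.1, h1⟩
    · exact hpβ u ⟨h1, hu.2⟩
  have hβI : β ∈ Icc 0 T := ⟨hα0.trans hαβ.le, hβ.2⟩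
  have hzj : ∀ u ∈ Ioo α β, z u j = 0 := by
    intro u hu
    by_contra hne'
    have huI : u ∈ Icc 0 T := ⟨hα0.trans hu.1.le, hu.2.le.trans hβ.2⟩
    have huj : 0 < z u j := (hP.nonneg u huI j).lt_of_ne (Ne.symm hne')
    have hsub' : Icc α u ⊆ Icc 0 T := Icc_subset_Icc hα0 huI.2
    obtain ⟨η, hη, hηj, hposj⟩ := exists_last_zero hu.1.le ((hP.continuousOn j).mono hsub')
      (fun v hv => hP.nonneg v (hsub' hv) j) hαj huj
    have hη0 : 0 ≤ η := hα0.trans hη.1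
    have hηI : η ∈ Icc 0 T := ⟨hη0, hη.2.le.trans huI.2⟩
    -- If `j` leaves zero together with `i`, the excursion of `i` started unregulated and never
    -- ends. If later, the excursion of `j` starts unregulated and lasts until `T`, so `j = i₀ = k`.
    rcases hη.1.eq_or_lt with rfl | hαη
    · refine hcon (h.opt.pos_of_start hR0 hα0 hu.1 huI.2 hαi
        (fun v hv => hposi v ⟨hv.1, hv.2.trans_lt hu.2⟩) (δ := u) ⟨hu.1, le_rfl⟩ fun l hli => ?_).1
      have hPu := hP.restrict hαI huI hu.1.le
      rcases hl l with rfl | rfl | rfl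
      · exact absurd rfl hli
      · exact hPu.y_eq_of_pos hu.1
          (fun v hv => hposj v ⟨hv.1, hv.2.le⟩) ⟨hu.1.le, le_rfl⟩ ⟨le_rfl, hu.1.le⟩
      · exact hPu.y_eq_of_pos hu.1
          (fun v hv => hposk v ⟨hv.1.le, hv.2.le.trans huI.2⟩) ⟨hu.1.le, le_rfl⟩ ⟨le_rfl, hu.1.le⟩
    · have hPη := hP.restrict hηI huI hη.2.le
      obtain ⟨δ, hδ, hy⟩ := hPη.exists_y_eq (S := Finset.univ.erase j) hη.2 fun l hl' => by
        rcases hl l with rfl | rfl | rfl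
        · exact hposi η ⟨hαη, hη.2.trans hu.2⟩
        · exact absurd rfl (Finset.ne_of_mem_erase hl')
        · exact hposk η ⟨hαη.le, hηI.2⟩
      have hp := (h.opt.pos_of_start hR0 hη0 hη.2 huI.2 hηj hposj hδ
        fun l hl' => hy l (Finset.mem_erase.2 ⟨hl', Finset.mem_univ l⟩)).1
      exact hkj (hk.trans (h.eq_of_end_pos (hp T ⟨hη.2.trans_le huI.2, le_rfl⟩)).symm)
  obtain ⟨p, q, hpq⟩ := h.opt.isLinearOn (circ_posDef (add_nonneg h.r₁_nonneg h.r₂_nonneg)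
    h.sum_lt) hα0 hαβ hβ.2 fun l => by
      rcases hl l with rfl | rfl | rfl
      · exact .inl hposi
      · exact .inr hzj
      · exact .inl fun u hu => hposk u ⟨hu.1.le, hu.2.le.trans hβ.2⟩
  have e1 := congrFun (hpq α ⟨le_rfl, hαβ.le⟩) i
  have e2 := congrFun (hpq β ⟨hαβ.le, le_rfl⟩) i
  have e3 := congrFun (hpq r ⟨hαr.le, hβ.1.le⟩) i
  have e4 := hpos r ⟨hαr, le_rfl⟩
  rw [hαi] at e1
  rw [hβ0] at e2
  simp only [Pi.add_apply, Pi.smul_apply, smul_eq_mul] at e1 e2 e3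
  have e5 : (β - α) * q i = 0 := by linarith
  have e6 : q i = 0 := (mul_eq_zero.1 e5).resolve_left (sub_pos.2 hαβ).ne'
  rw [e6] at e1 e3
  linarith

end IsAxisOpt

end

/-! ### From sign changes to the number of segments -/

section

theorem IsLinearOn.union {d : ℕ} {z : ℝ → Fin d → ℝ} {s t a b : ℝ} (h : IsLinearOn z s t)
    (h' : IsLinearOn z a b) (hsa : s ≤ a) (hat : a < t) (htb : t ≤ b) : IsLinearOn z s b := by
  obtain ⟨p, q, hpq⟩ := h
  obtain ⟨p', q', hpq'⟩ := h'
  have e1 := (hpq a ⟨hsa, hat.le⟩).symm.trans (hpq' a ⟨le_rfl, hat.le.trans htb⟩)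
  have e2 := (hpq t ⟨hsa.trans hat.le, le_rfl⟩).symm.trans (hpq' t ⟨hat.le, htb⟩)
  have hq : q = q' := by
    funext i
    have f1 := congrFun e1 i
    have f2 := congrFun e2 i
    simp only [Pi.add_apply, Pi.smul_apply, smul_eq_mul] at f1 f2
    have : (t - a) * (q i - q' i) = 0 := by linarith
    exact sub_eq_zero.1 ((mul_eq_zero.1 this).resolve_left (sub_pos.2 hat).ne')
  subst hq
  have hp : p = p' := add_right_cancel e1
  subst hp
  refine ⟨p, q, fun r hr => ?_⟩
  rcases le_total r t with h1 | h1
  · exact hpq r ⟨hr.1, h1⟩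
  · exact hpq' r ⟨hat.le.trans h1, hr.2⟩

/-- A path which is linear between consecutive points of a finite set has finitely many
segments. -/
theorem finite_segments {d : ℕ} {z : ℝ → Fin d → ℝ} {T : ℝ} {F : Set ℝ} (hF : F.Finite)
    (h : ∀ s t, 0 ≤ s → s < t → t ≤ T → Disjoint (Ioo s t) F → IsLinearOn z s t) :
    (segments z T).Finite := by
  have hF' : (F ∪ {0, T}).Finite := hF.union (by simp)
  have hnear : ∀ a, a ∉ F → ∃ ε > 0, Disjoint (Ioo (a - ε) (a + ε)) F := by
    intro a ha
    obtain ⟨ε, hε, hb⟩ := Metric.isOpen_iff.1 hF.isClosed.isOpen_compl a ha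
    rw [Real.ball_eq_Ioo] at hb
    exact ⟨ε, hε, disjoint_left.2 fun x hx hxF => hb hx hxF⟩
  -- A segment endpoint outside `F ∪ {0, T}` is interior to an interval on which `z` is linear; the
  -- union with the segment would contradict maximality.
  refine (hF'.prod hF').subset fun x hx => ?_
  obtain ⟨a, b⟩ := x
  obtain ⟨hab, ha, hb, hlin, hmax⟩ := hx
  simp only at hab ha hb hlin hmax
  constructor
  · by_contra hcon
    simp only [mem_union, mem_insert_iff, mem_singleton_iff, not_or] at hcon
    obtain ⟨haF, ha0, -⟩ := hcon
    obtain ⟨ε, hε, hdis⟩ := hnear a haF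
    have ha' : 0 < a := ha.lt_of_ne (Ne.symm ha0)
    have hs : max 0 (a - ε) < a := max_lt ha' (by linarith)
    have ht : a < min b (a + ε) := lt_min hab (by linarith)
    have h1 := h (max 0 (a - ε)) (min b (a + ε)) (le_max_left _ _) (hs.trans ht)
      ((min_le_left _ _).trans hb)
      (hdis.mono_left (Ioo_subset_Ioo (le_max_right _ _) (min_le_right _ _)))
    have h2 := (h1.union hlin hs.le ht (min_le_left _ _))
    exact hs.ne (hmax _ _ (le_max_left _ _) hs.le le_rfl hb h2).1
  · by_contra hcon
    simp only [mem_union, mem_insert_iff, mem_singleton_iff, not_or] at hcon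
    obtain ⟨hbF, -, hbT⟩ := hcon
    obtain ⟨ε, hε, hdis⟩ := hnear b hbF
    have hb' : b < T := hb.lt_of_ne hbT
    have hs : max a (b - ε) < b := max_lt hab (by linarith)
    have ht : b < min T (b + ε) := lt_min hb' (by linarith)
    have h1 := h (max a (b - ε)) (min T (b + ε)) (ha.trans (le_max_left _ _)) (hs.trans ht)
      (min_le_left _ _)
      (hdis.mono_left (Ioo_subset_Ioo (le_max_right _ _) (min_le_right _ _)))
    have h2 := hlin.union h1 (le_max_left _ _) hs ht.le
    exact ht.ne' (hmax _ _ ha le_rfl ht.le (min_le_left _ _) h2).2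

/-- If `f` becomes positive only finitely often, its sign changes finitely often. -/
theorem exists_finite_sign_changes {f : ℝ → ℝ} {T : ℝ} (hf : ContinuousOn f (Icc 0 T))
    (h0 : ∀ t ∈ Icc 0 T, 0 ≤ f t) (hf0 : f 0 = 0) {S : Set ℝ} (hS : S.Finite)
    (hstart : ∀ α r, 0 ≤ α → α < r → r ≤ T → f α = 0 → (∀ t ∈ Ioc α r, 0 < f t) → α ∈ S) :
    ∃ F : Set ℝ, F.Finite ∧ ∀ s t, 0 ≤ s → s < t → t ≤ T → Disjoint (Ioo s t) F →
      (∀ r ∈ Ioo s t, 0 < f r) ∨ ∀ r ∈ Ioo s t, f r = 0 := by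
  -- The end `c` of the excursion starting at `α`, with a dummy value if none starts. It depends on
  -- `α` alone, so the starts in `S` and their ends form a finite set.
  have hend : ∀ α : ℝ, ∃ c, (∃ r, 0 ≤ α ∧ α < r ∧ r ≤ T ∧ ∀ t ∈ Ioc α r, 0 < f t) →
      α < c ∧ (∀ t ∈ Ioo α c, 0 < f t) ∧ (f c = 0 ∨ c = T) := by
    intro α
    by_cases hα : ∃ r, 0 ≤ α ∧ α < r ∧ r ≤ T ∧ ∀ t ∈ Ioc α r, 0 < f t
    swap
    · exact ⟨0, fun h => absurd h hα⟩
    obtain ⟨r, hα0, hαr, hrT, hpos⟩ := hα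
    by_cases hz : ∃ u ∈ Icc r T, f u = 0
    · obtain ⟨u, hu, hfu⟩ := hz
      have hsub : Icc r u ⊆ Icc 0 T := Icc_subset_Icc (hα0.trans hαr.le) hu.2
      obtain ⟨c, hc, hc0, hcp⟩ := exists_first_zero hu.1 (hf.mono hsub)
        (fun v hv => h0 v (hsub hv)) (hpos r ⟨hαr, le_rfl⟩) hfu
      refine ⟨c, fun _ => ⟨hαr.trans hc.1, fun t ht => ?_, .inl hc0⟩⟩
      rcases le_total t r with h1 | h1
      · exact hpos t ⟨ht.1, h1⟩
      · exact hcp t ⟨h1, ht.2⟩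
    · push Not at hz
      refine ⟨T, fun _ => ⟨hαr.trans_le hrT, fun t ht => ?_, .inr rfl⟩⟩
      rcases le_total t r with h1 | h1
      · exact hpos t ⟨ht.1, h1⟩
      · exact (h0 t ⟨hα0.trans ht.1.le, ht.2.le⟩).lt_of_ne (hz t ⟨h1, ht.2.le⟩).symm
  choose c hc using hend
  refine ⟨S ∪ c '' S, hS.union (hS.image c), fun s t hs hst htT hdis => ?_⟩
  by_cases hall : ∀ r ∈ Ioo s t, f r = 0
  · exact .inr hall
  refine .inl ?_
  push Not at hall
  obtain ⟨r, hr, hfr⟩ := hall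
  have hrT : r ≤ T := hr.2.le.trans htT
  have hr0 : 0 ≤ r := hs.trans hr.1.le
  have hsub : Icc 0 r ⊆ Icc 0 T := Icc_subset_Icc le_rfl hrT
  obtain ⟨α, hα, hα0, hαp⟩ := exists_last_zero hr0 (hf.mono hsub) (fun v hv => h0 v (hsub hv)) hf0
    ((h0 r ⟨hr0, hrT⟩).lt_of_ne hfr.symm)
  have hαS := hstart α r hα.1 hα.2 hrT hα0 hαp
  have hαs : α ≤ s := by
    by_contra hcon
    exact disjoint_left.1 hdis ⟨not_le.1 hcon, hα.2.trans hr.2⟩ (.inl hαS)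
  obtain ⟨h3, h1, h2⟩ := hc α ⟨r, hα.1, hα.2, hrT, hαp⟩
  have hct : t ≤ c α := by
    by_contra hcon
    have hcs : c α ≤ s := by
      by_contra hcon'
      exact disjoint_left.1 hdis ⟨not_le.1 hcon', not_le.1 hcon⟩ (.inr ⟨α, hαS, rfl⟩)
    rcases h2 with h2 | h2
    · have := hαp (c α) ⟨h3, hcs.trans hr.1.le⟩
      linarith
    · linarith
  exact fun u hu => h1 u ⟨hαs.trans_lt hu.1, hu.2.trans_le hct⟩

theorem IsAxisOpt.finite_segments {θ₀ r₁ r₂ T : ℝ} {g y z : ℝ → Fin 3 → ℝ} {i₀ : Fin 3}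
    {x₀ κ : ℝ} (h : IsAxisOpt θ₀ r₁ r₂ T g y z i₀ x₀ κ) (hno : ¬ HasDirectStep θ₀ r₁ r₂ κ) :
    (segments z T).Finite := by
  have hP := h.opt.piece
  obtain ⟨t₀, ht₀, hzero, hne⟩ := h.exists_last_origin
  have hz₀ := hzero t₀ ⟨ht₀.1, le_rfl⟩
  have hsign : ∀ i, ∃ F : Set ℝ, F.Finite ∧ ∀ s t, 0 ≤ s → s < t → t ≤ T → Disjoint (Ioo s t) F →
      (∀ r ∈ Ioo s t, 0 < z r i) ∨ ∀ r ∈ Ioo s t, z r i = 0 := by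
    intro i
    -- Excursions of coordinate `i` that start strictly after the last time at the origin. Each
    -- lasts until `T`, so there is at most one.
    set S' : Set ℝ := {α | t₀ < α ∧ z α i = 0 ∧ ∃ r, α < r ∧ r ≤ T ∧ ∀ t ∈ Ioc α r, 0 < z t i}
      with hS'
    have hS's : S'.Subsingleton := by
      have key : ∀ α ∈ S', ∀ β ∈ S', ¬ α < β := by
        rintro α ⟨hα, hαi, r, hαr, hr, hpos⟩ β ⟨-, hβi, r', hβr', hr', -⟩ hlt
        have := h.pos_after_start hno ht₀.1 hz₀ hne hα hαr hr hαi hpos β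
          ⟨hlt, hβr'.le.trans hr'⟩
        linarith
      intro α hα β hβ
      exact le_antisymm (not_lt.1 (key β hβ α hα)) (not_lt.1 (key α hα β hβ))
    refine exists_finite_sign_changes (hP.continuousOn i) (fun t ht => hP.nonneg t ht i)
      (by rw [h.opt.zero]; rfl) (S := {t₀} ∪ S') ((finite_singleton _).union hS's.finite)
      fun α r hα hαr hr hαi hpos => ?_
    rcases lt_trichotomy α t₀ with hlt | rfl | hlt
    · have h1 := hpos (min r t₀) ⟨lt_min hαr hlt, min_le_left _ _⟩
      rw [hzero _ ⟨hα.trans (lt_min hαr hlt).le, min_le_right _ _⟩] at h1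
      exact absurd h1 (lt_irrefl _)
    · exact .inl rfl
    · exact .inr ⟨hlt, hαi, r, hαr, hr, hpos⟩
  choose F hF hFs using hsign
  refine RSVP.finite_segments (F := ⋃ i, F i) (finite_iUnion hF) fun s t hs hst ht hdis => ?_
  exact h.opt.isLinearOn (circ_posDef (add_nonneg h.r₁_nonneg h.r₂_nonneg) h.sum_lt) hs hst ht
    fun i => hFs i s t hs hst ht (hdis.mono_right (subset_iUnion F i))

end

/-! ### The geometric spiral generated by a direct step -/

section

theorem intervalIntegrable_comp_finite {ι : Type*} [Fintype ι] [MeasurableSpace ι]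
    [DiscreteMeasurableSpace ι] {M : ℝ → ι} (hM : Measurable M) (φ : ι → ℝ) (s t : ℝ) :
    IntervalIntegrable (fun r => φ (M r)) volume s t := by
  refine (intervalIntegrable_const (c := ∑ i, |φ i|)).mono_fun'
    ((Measurable.of_discrete.comp hM).aestronglyMeasurable) (ae_of_all _ fun r => ?_)
  exact Finset.single_le_sum (f := fun i => |φ i|) (fun i _ => abs_nonneg _) (Finset.mem_univ _)

/-- The index `n` with `t ∈ (T s ^ (n + 1), T s ^ n]`. -/
noncomputable def geomIndex (T s t : ℝ) : ℕ := ⌊(Real.log T - Real.log t) / -Real.log s⌋₊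

theorem measurable_geomIndex (T s : ℝ) : Measurable (geomIndex T s) :=
  Nat.measurable_floor.comp ((measurable_const.sub Real.measurable_log).div_const _)

theorem geomIndex_eq {T s t : ℝ} (hT : 0 < T) (hs : 0 < s) (hs1 : s < 1) {n : ℕ}
    (ht : t ∈ Ioc (T * s ^ (n + 1)) (T * s ^ n)) : geomIndex T s t = n := by
  have hL : 0 < -Real.log s := neg_pos.2 (Real.log_neg hs hs1)
  have h0 : 0 < T * s ^ (n + 1) := by positivity
  have h1 := Real.log_lt_log h0 ht.1
  have h2 := Real.log_le_log (h0.trans ht.1) ht.2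
  rw [Real.log_mul hT.ne' (by positivity), Real.log_pow] at h1 h2
  push_cast at h1
  have h3 : (n : ℝ) ≤ (Real.log T - Real.log t) / -Real.log s := by
    rw [le_div_iff₀ hL]; linarith
  unfold geomIndex
  rw [Nat.floor_eq_iff (n.cast_nonneg.trans h3)]
  refine ⟨h3, ?_⟩
  rw [div_lt_iff₀ hL]
  linarith

theorem exists_geomIndex {T s t : ℝ} (hs : 0 < s) (hs1 : s < 1) (ht : t ∈ Ioc 0 T) :
    ∃ n : ℕ, t ∈ Ioc (T * s ^ (n + 1)) (T * s ^ n) := by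
  have hT := ht.1.trans_le ht.2
  obtain ⟨n, h1, h2⟩ := exists_nat_pow_near_of_lt_one (div_pos ht.1 hT) ((div_le_one hT).2 ht.2)
    hs hs1
  rw [lt_div_iff₀ hT] at h1
  rw [div_le_iff₀ hT] at h2
  exact ⟨n, by linarith, by linarith⟩

/-- A direct step, repeated after rescaling and rotation, gives a classic spiral. -/
theorem HasDirectStep.exists_spiral {θ₀ r₁ r₂ κ : ℝ} (h : HasDirectStep θ₀ r₁ r₂ κ) (i₀ : Fin 3)
    {x₀ : ℝ} (hx₀ : 0 < x₀) :
    ∃ (T : ℝ) (g y z : ℝ → Fin 3 → ℝ), IsPiece (fun _ => θ₀) (circ r₁ r₂) 0 T g y z ∧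
      z T = Pi.single i₀ x₀ ∧ IsClassicSpiral z T ∧ energy g 0 T ≤ κ * x₀ := by
  obtain ⟨i, j, k, a, b, D, u, γ, hji, hki, hkj, ha, hab, hD, hu, hstep, hcost⟩ := h
  have hb := ha.trans hab
  set s := a / b with hs
  have hs0 : 0 < s := div_pos ha hb
  have hs1 : s < 1 := (div_lt_one hb).2 hab
  -- The sum of the durations `x₀ * s ^ n / b * D` of the rescaled steps, where `s = a / b` is the
  -- contraction per step.
  set T := D * x₀ / (b - a) with hT
  have hba : 0 < b - a := sub_pos.2 hab
  have hT0 : 0 < T := by positivity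
  -- The rotation applied to the `n`-th copy, counted back from `T`. It is chosen so that the last
  -- copy ends on axis `i₀` and each copy starts on the axis where the preceding one in time ends
  -- (`hm1`).
  set m : ℕ → Fin 3 := fun n => (i₀ - i) + n • (j - i) with hm
  have hm1 : ∀ n, i + m (n + 1) = j + m n := fun n => by
    simp only [hm, succ_nsmul]; abel
  set M : ℝ → Fin 3 := fun t => m (geomIndex T s t) with hMd
  have hM : Measurable M := (Measurable.of_discrete (f := m)).comp (measurable_geomIndex T s)
  set t : ℕ → ℝ := fun n => T * s ^ n with ht
  have ht0 : ∀ n, 0 < t n := fun n => by positivity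
  have htanti : StrictAnti t := fun p q hpq =>
    mul_lt_mul_of_pos_left (pow_lt_pow_right_of_lt_one₀ hs0 hs1 hpq) hT0
  have htlim : Tendsto t atTop (𝓝 0) := by
    simpa using (tendsto_pow_atTop_nhds_zero_of_lt_one hs0.le hs1).const_mul T
  have hint := fun (φ : Fin 3 → ℝ) => intervalIntegrable_comp_finite hM φ
  have hconst : ∀ (φ : Fin 3 → ℝ) n, ∀ r ∈ Icc (t (n + 1)) (t n),
      ∫ v in t (n + 1)..r, φ (M v) = (r - t (n + 1)) * φ (m n) := by
    intro φ n r hr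
    rw [intervalIntegral.integral_congr_ae (g := fun _ => φ (m n)) (ae_of_all _ fun v hv => ?_)]
    · simp
    · rw [uIoc_of_le hr.1] at hv
      simp only [hMd]
      rw [geomIndex_eq hT0 hs0 hs1 (n := n) ⟨hv.1, hv.2.trans hr.2⟩]
  set w : Fin 3 → Fin 3 → ℝ := fun l p => if l = k + p then u else 0 with hw
  set g : ℝ → Fin 3 → ℝ := fun r l => γ (l - M r) with hg
  set y : ℝ → Fin 3 → ℝ := fun r l => ∫ v in (0 : ℝ)..r, w l (M v) with hy
  set V : Fin 3 → ℝ := fun l => θ₀ + γ l + circ r₁ r₂ l k * u with hV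
  set z : ℝ → Fin 3 → ℝ := fun r l => ∫ v in (0 : ℝ)..r, V (l - M v) with hz
  set P : ℕ → Fin 3 → ℝ := fun n => Pi.single (i + m n) (x₀ * s ^ n) with hP
  have hwV : ∀ l p, V (l - p) = θ₀ + γ (l - p) + ∑ l', circ r₁ r₂ l l' * w l' p := by
    intro l p
    rw [Finset.sum_eq_single (k + p) (fun l' _ hl' => by simp [hw, hl']) (by simp)]
    have := circ_add r₁ r₂ p (l - p) k
    rw [sub_add_cancel] at this
    simp [hV, hw, this]
  have hsingle : ∀ (l p q : Fin 3) (c c' : ℝ), (Pi.single (q + p) (c * c') : Fin 3 → ℝ) l =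
      c * (Pi.single q c' : Fin 3 → ℝ) (l - p) := by
    intro l p q c c'
    by_cases hl : l = q + p
    · subst hl; simp
    · have : l - p ≠ q := fun h => hl (by rw [← h]; abel)
      simp [hl, this]
  have hdt : ∀ n, t n - t (n + 1) = x₀ * s ^ n / b * D := fun n => by
    simp only [ht, hT, pow_succ]
    have : b * s = a := by rw [hs]; field_simp
    have h2 : D * x₀ / (b - a) * s ^ n - D * x₀ / (b - a) * (s ^ n * s) =
        D * x₀ * s ^ n / (b - a) * (1 - s) := by ring
    rw [h2]
    have h3 : 1 - s = (b - a) / b := by rw [hs]; field_simp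
    rw [h3]
    field_simp
  have hdP : ∀ n l, P n l - P (n + 1) l = (t n - t (n + 1)) * V (l - m n) := by
    intro n l
    have h1 : P n l = x₀ * s ^ n / b * (Pi.single i b : Fin 3 → ℝ) (l - m n) := by
      rw [← hsingle, show x₀ * s ^ n / b * b = x₀ * s ^ n by field_simp]
    have h2 : P (n + 1) l = x₀ * s ^ n / b * (Pi.single j a : Fin 3 → ℝ) (l - m n) := by
      rw [← hsingle, ← hm1,
        show x₀ * s ^ n / b * a = x₀ * s ^ (n + 1) by rw [pow_succ, hs]; field_simp]
    rw [h1, h2, hdt, ← mul_sub, hstep]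
    simp only [hV]
    ring
  have hzc : ∀ l, Continuous fun r => z r l := fun l =>
    intervalIntegral.continuous_primitive (fun _ _ => hint (fun p => V (l - p)) _ _) 0
  have hzinc : ∀ n l, ∀ r ∈ Icc (t (n + 1)) (t n),
      z r l = z (t (n + 1)) l + (r - t (n + 1)) * V (l - m n) := by
    intro n l r hr
    rw [← hconst (fun p => V (l - p)) n r hr]
    exact (intervalIntegral.integral_add_adjacent_intervals
      (hint (fun p => V (l - p)) _ _) (hint (fun p => V (l - p)) _ _)).symm
  -- `z` and the intended corners `P` have the same increments, so their difference is constant in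
  -- `n`; it is zero because both tend to the origin.
  have hzP : ∀ n, z (t n) = P n := by
    have hconst' : ∀ l n, z (t n) l - P n l = z (t 0) l - P 0 l := by
      intro l n
      induction n with
      | zero => rfl
      | succ n ih =>
        have h1 := hzinc n l (t n) ⟨(htanti n.lt_succ_self).le, le_rfl⟩
        have h2 := hdP n l
        linarith
    intro n
    funext l
    have hlimz : Tendsto (fun n => z (t n) l) atTop (𝓝 0) := by
      have h1 := ((hzc l).tendsto 0).comp htlim
      simpa [hz, Function.comp_def] using h1
    have hlimP : Tendsto (fun n => P n l) atTop (𝓝 0) := by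
      have h1 : Tendsto (fun n => x₀ * s ^ n) atTop (𝓝 0) := by
        simpa using (tendsto_pow_atTop_nhds_zero_of_lt_one hs0.le hs1).const_mul x₀
      refine squeeze_zero (fun n => ?_) (fun n => ?_) h1
      · simp only [hP, Pi.single_apply]; split_ifs <;> positivity
      · simp only [hP, Pi.single_apply]; split_ifs
        · exact le_rfl
        · positivity
    have hlim := hlimz.sub hlimP
    simp only [hconst' l, sub_zero] at hlim
    have h3 := tendsto_nhds_unique hlim tendsto_const_nhds
    have h4 := hconst' l n
    linarith
  have hzline : ∀ n, ∀ r ∈ Icc (t (n + 1)) (t n), ∀ l,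
      z r l = P (n + 1) l + (r - t (n + 1)) * V (l - m n) := by
    intro n r hr l
    rw [hzinc n l r hr, hzP]
  have hPnn : ∀ n l, 0 ≤ P n l := fun n l => by
    simp only [hP, Pi.single_apply]; split_ifs <;> positivity
  have hTt : t 0 = T := by simp [ht]
  have hznn : ∀ r ∈ Icc 0 T, ∀ l, 0 ≤ z r l := by
    intro r hr l
    rcases hr.1.eq_or_lt with rfl | hr0
    · simp [hz]
    obtain ⟨n, hn⟩ := exists_geomIndex hs0 hs1 (show r ∈ Ioc 0 T from ⟨hr0, hr.2⟩)
    change r ∈ Ioc (t (n + 1)) (t n) at hn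
    have h1 := hzline n r ⟨hn.1.le, hn.2⟩ l
    have h2 := hdP n l
    have h3 := hPnn n l
    have h4 := hPnn (n + 1) l
    rcases le_total 0 (V (l - m n)) with h5 | h5
    · rw [h1]
      exact add_nonneg h4 (mul_nonneg (sub_nonneg.2 hn.1.le) h5)
    · have : (t n - r) * V (l - m n) ≤ 0 :=
        mul_nonpos_of_nonneg_of_nonpos (sub_nonneg.2 hn.2) h5
      linarith
  have hVk : V k = 0 := by
    have := hstep k
    simp only [Pi.single_eq_of_ne hki, Pi.single_eq_of_ne hkj, sub_zero] at this
    exact (mul_eq_zero.1 this.symm).resolve_left hD.ne'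
  have hzk : ∀ n, ∀ r ∈ Icc (t (n + 1)) (t n), z r (k + m n) = 0 := by
    intro n r hr
    rw [hzline n r hr, add_sub_cancel_right, hVk]
    simp [hP, hm1, hkj]
  have hpiece : IsPiece (fun _ => θ₀) (circ r₁ r₂) 0 T g y z := by
    refine ⟨hT0.le, fun l => hint (fun p => γ (l - p)) _ _,
      fun l => hint (fun p => γ (l - p) ^ 2) _ _, fun l => ?_, fun l r _ r' _ hrr' => ?_,
      fun r hr l => ?_, hznn, fun l r hr r' hr' hrr' hpos => ?_⟩
    · exact (intervalIntegral.continuous_primitive (fun _ _ => hint (w l) _ _) 0).continuousOn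
    · have h1 : 0 ≤ ∫ v in r..r', w l (M v) := intervalIntegral.integral_nonneg hrr' fun v _ => by
        simp only [hw]; split_ifs
        · exact hu
        · exact le_rfl
      have h2 := intervalIntegral.integral_interval_sub_left (hint (w l) 0 r') (hint (w l) 0 r)
      simp only [hy]
      linarith
    · have h1 : z r l = ∫ v in (0 : ℝ)..r, (θ₀ + γ (l - M v) +
          ∑ l', circ r₁ r₂ l l' * w l' (M v)) := by
        simp only [hz, hwV]
      rw [h1, intervalIntegral.integral_add
        (intervalIntegrable_const.add (hint (fun p => γ (l - p)) _ _))
        (hint (fun p => ∑ l', circ r₁ r₂ l l' * w l' p) _ _),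
        intervalIntegral.integral_add intervalIntegrable_const (hint (fun p => γ (l - p)) _ _),
        intervalIntegral.integral_finsetSum fun l' _ => (hint (w l') _ _).const_mul _]
      simp [hz, hy, hg]
    · have h2 := intervalIntegral.integral_interval_sub_left (hint (w l) 0 r') (hint (w l) 0 r)
      have h3 : ∫ v in r..r', w l (M v) = 0 := by
        rw [intervalIntegral.integral_congr_ae (g := fun _ => 0) (ae_of_all _ fun v hv => ?_)]
        · simp
        rw [uIoc_of_le hrr'] at hv
        obtain ⟨n, hn⟩ := exists_geomIndex hs0 hs1
          (show v ∈ Ioc 0 T from ⟨hr.1.trans_lt hv.1, hv.2.trans hr'.2⟩)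
        have hMv : M v = m n := by simp only [hMd]; rw [geomIndex_eq hT0 hs0 hs1 hn]
        simp only [hw, hMv, ite_eq_right_iff]
        rintro rfl
        have h4 := hpos v ⟨hv.1.le, hv.2⟩
        rw [hzk n v ⟨hn.1.le, hn.2⟩] at h4
        exact absurd h4 (lt_irrefl _)
      rw [h3] at h2
      simp only [hy]
      linarith
  refine ⟨T, g, y, z, hpiece, ?_, ⟨by funext l; simp [hz], t, fun n => i + m n, j - i, hTt, htanti,
    htlim, sub_ne_zero.2 hji, fun n => ?_, fun n => ⟨?_, ?_⟩⟩, ?_⟩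
  · rw [← hTt, hzP]
    simp [hP, hm]
  · change i + m (n + 1) = i + m n + (j - i)
    rw [hm1]; abel
  · rw [hzP]
    refine ⟨?_, fun l hl => ?_⟩
    · simp only [hP, Pi.single_eq_same]; positivity
    · simp [hP, hl]
  · refine ⟨P (n + 1) - t (n + 1) • (fun l => V (l - m n)), fun l => V (l - m n), fun r hr => ?_⟩
    funext l
    rw [hzline n r hr l]
    simp only [Pi.add_apply, Pi.sub_apply, Pi.smul_apply, smul_eq_mul]
    ring
  · have h1 : energy g 0 T = 1 / 2 * (T * ∑ l, γ l ^ 2) := by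
      unfold energy
      -- Rotation only permutes the entries of `γ`, so the running cost is constant in time.
      have h2 : ∀ v, ∑ l, γ (l - M v) ^ 2 = ∑ l, γ l ^ 2 := fun v =>
        Equiv.sum_comp (Equiv.subRight (M v)) fun l => γ l ^ 2
      have h3 : ∑ l, ∫ v in (0 : ℝ)..T, γ (l - M v) ^ 2 =
          ∫ v in (0 : ℝ)..T, ∑ l, γ (l - M v) ^ 2 :=
        (intervalIntegral.integral_finsetSum fun l _ =>
          hint (fun p => γ (l - p) ^ 2) _ _).symm
      simp only [h2] at h3
      rw [h3]
      simp
    rw [h1, hT]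
    have h3 : 1 / 2 * (D * x₀ / (b - a) * ∑ l, γ l ^ 2) =
        (1 / 2 * D * ∑ l, γ l ^ 2) * (x₀ / (b - a)) := by ring
    rw [h3]
    calc _ ≤ κ * (b - a) * (x₀ / (b - a)) :=
          mul_le_mul_of_nonneg_right hcost (div_pos hx₀ hba).le
      _ = κ * x₀ := by field_simp

theorem IsClassicSpiral.congr {z z' : ℝ → Fin 3 → ℝ} {T : ℝ} (h : IsClassicSpiral z T)
    (hzz' : ∀ t ∈ Icc 0 T, z' t = z t) : IsClassicSpiral z' T := by
  obtain ⟨hz0, t, i, δ, ht0, hanti, hlim, hδ, hi, hn⟩ := h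
  have htpos : ∀ n, 0 ≤ t n := fun n => hanti.antitone.le_of_tendsto hlim n
  have htT : ∀ n, t n ≤ T := fun n => ht0 ▸ hanti.antitone n.zero_le
  refine ⟨by rw [hzz' 0 ⟨le_rfl, ht0 ▸ htpos 0⟩, hz0], t, i, δ, ht0, hanti, hlim, hδ, hi,
    fun n => ⟨by rw [hzz' _ ⟨htpos n, htT n⟩]; exact (hn n).1, ?_⟩⟩
  obtain ⟨p, q, hpq⟩ := (hn n).2
  exact ⟨p, q, fun r hr => by
    rw [hzz' r ⟨(htpos _).trans hr.1, hr.2.trans (htT n)⟩, hpq r hr]⟩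

end

end RSVP

/-! ### Conclusion: the dichotomy applied to the given optimal triple -/

theorem mainTheorem3 (θ : Fin 3 → ℝ) (Γ R : Matrix (Fin 3) (Fin 3) ℝ) (θ₀ r₁ r₂ : ℝ)
    (hsymm : RSVP.IsRotationallySymmetric θ Γ R θ₀ r₁ r₂) (hΓ : Γ = 1)
    (hθ₀ : θ₀ < 0) (hr₁ : 0 ≤ r₁) (hr₂ : 0 ≤ r₂) (hcond : RSVP.Condition1 r₁ r₂)
    (v : Fin 3 → ℝ) (hv : ∃ i, v ∈ RSVP.axisInterior i)
    (T : ℝ) (x y z : ℝ → Fin 3 → ℝ)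
    (hopt : RSVP.IsOptimalTriple θ Γ R v T x y z)
    (hseg : RSVP.HasCountablyInfinitelyManySegments z T) :
    ∃ (T' : ℝ) (x' y' z' : ℝ → Fin 3 → ℝ),
      RSVP.IsFeasible R v T' x' y' z' ∧ RSVP.IsClassicSpiral z' T' ∧
        RSVP.cost θ Γ x' T' ≤ RSVP.cost θ Γ x T := by
  obtain ⟨i, hvi, hvj⟩ := hv
  have hv' : v = Pi.single i (v i) := by
    funext l
    by_cases hl : l = i
    · subst hl; simp
    · simp [hl, hvj l hl]
  obtain rfl : R = RSVP.circ r₁ r₂ := hsymm.reflection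
  obtain rfl : θ = fun _ => θ₀ := by
    rw [hsymm.drift]; funext l; fin_cases l <;> rfl
  subst hΓ
  obtain ⟨hfeas, hval⟩ := hopt
  obtain ⟨hpiece, hcost⟩ :=
    hfeas.regulation.isPiece (θ := fun _ => θ₀) hfeas.path hfeas.time_nonneg
  have hz0 : z 0 = 0 := by
    rw [hfeas.regulation.eq 0 le_rfl, hfeas.path.zero, hfeas.regulation.y_zero]
    simp
  have hvne := hvi.ne'
  -- Dividing the optimal cost by the distance of `v` from the origin gives `κ`, so the spiral's
  -- bound `κ * v i` is the given cost.
  have haxis : RSVP.IsAxisOpt θ₀ r₁ r₂ T (fun t => deriv x t - fun _ => θ₀) y z i (v i)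
      (RSVP.cost (fun _ => θ₀) 1 x T / v i) := by
    refine ⟨⟨hpiece, hz0, fun c hc => ?_⟩, hr₁, hr₂, hcond.1.2.2.2.2, hθ₀,
      by rw [hfeas.terminal]; exact hv', hvi, ?_⟩
    · rw [← hcost, hval]
      rw [hfeas.terminal] at hc
      exact RSVP.value_le_of_reach hc
    · rw [← hcost]; field_simp
  have hstep : RSVP.HasDirectStep θ₀ r₁ r₂ (RSVP.cost (fun _ => θ₀) 1 x T / v i) := by
    by_contra hno
    exact hseg.1 (haxis.finite_segments hno)
  obtain ⟨T', g', y', z', hP, hzT, hspiral, hE⟩ := hstep.exists_spiral i hvi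
  obtain ⟨x'', y'', z'', hf, hzz, hc⟩ := hP.exists_isFeasible hspiral.1
  rw [hzT, ← hv'] at hf
  refine ⟨T', x'', y'', z'', hf, hspiral.congr hzz, ?_⟩
  rw [hc]
  refine hE.trans (le_of_eq ?_)
  field_simp
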